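/- Let $d>2$ and $n\ge 0$ be integers, and let $\mathcal H_n^d$ be the space of real harmonic polynomials on $\mathbb R^d$ that are homogeneous of degree $n$. Let $d\sigma$ be the surface measure on the unit sphere $\mathbb S^{d-1}$, $\omega_d=\sigma(\mathbb S^{d-1})$, and $$\langle f,g\rangle_{\mathbb S^{d-1}}=\frac1{\omega_d}\int_{\mathbb S^{d-1}}f(x)g(x)\,d\sigma(x).$$ Use the spherical polar coordinates $$x_1=r\sin\theta_{d-1}\cdots\sin\theta_2\sin\theta_1,\qquad x_k=r\sin\theta_{d-1}\cdots\sin\theta_{k}\cos\theta_{k-1}\quad(2\le k\le d),$$ (so that $x_d=r\cos\theta_{d-1}$), where $r\ge0$, $0\le\theta_1\le2\pi$ and $0\le\theta_i\le\pi$ for $2\le i\le d-1$. Let $(a)_m=a(a+1)\cdots(a+m-1)$, and for $\lambda>0$ let $$C_m^\lambda(t)=\frac{(\lambda)_m2^m}{m!}\,t^m\,{}_2F_1\!\left(-\tfrac m2,\tfrac{1-m}2;1-m-\lambda;\tfrac1{t^2}\right)=\frac{(\lambda)_m2^m}{m!}\sum_{0\le i\le m/2}\frac{(-\frac m2)_i(\frac{1-m}2)_i}{i!\,(1-m-\lambda)_i}\,t^{m-2i}$$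 be the Gegenbauer polynomial of degree $m$. For $\alpha\in\mathbb N_0^d$ with $\alpha_d\in\{0,1\}$ put $$|\alpha^j|=\alpha_j+\cdots+\alpha_{d-1},\qquad \lambda_j=|\alpha^{j+1}|+\frac{d-j-1}2,$$ let $g_\alpha(\theta_1)=\cos(\alpha_{d-1}\theta_1)$ if $\alpha_d=0$ and $g_\alpha(\theta_1)=\sin(\alpha_{d-1}\theta_1)$ if $\alpha_d=1$, and let $h_\alpha>0$ be given by $$[h_\alpha]^2=b_\alpha\prod_{j=1}^{d-2}\frac{\alpha_j!\,\bigl(\frac{d-j+1}2\bigr)_{|\alpha^{j+1}|}(\alpha_j+\lambda_j)}{(2\lambda_j)_{\alpha_j}\bigl(\frac{d-j}2\bigr)_{|\alpha^{j+1}|}\lambda_j},$$ where $b_\alpha=2$ if $\alpha_{d-1}+\alpha_d>0$ and $b_\alpha=1$ otherwise. Define $$Y_\alpha(x)=h_\alpha\,r^{|\alpha^1|}g_\alpha(\theta_1)\prod_{j=1}^{d-2}(\sin\theta_{d-j})^{|\alpha^{j+1}|}C_{\alpha_j}^{\lambda_j}(\cos\theta_{d-j}).$$ Then the functions $Y_\alpha$,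 where $\alpha$ ranges over all $\alpha\in\mathbb N_0^d$ with $|\alpha^1|=\alpha_1+\cdots+\alpha_{d-1}=n$, $\alpha_d\in\{0,1\}$, and $\alpha_{d-1}\ge1$ whenever $\alpha_d=1$, form an orthonormal basis of $\mathcal H_n^d$: each $Y_\alpha$ is (the function given by) an element of $\mathcal H_n^d$, these elements form a basis of $\mathcal H_n^d$, and $\langle Y_\alpha,Y_\beta\rangle_{\mathbb S^{d-1}}=\delta_{\alpha,\beta}$. -/

import Mathlib

open MeasureTheory

noncomputable section

namespace SphericalHarmonics

/-- The Laplacian `∂₁² + ⋯ + ∂_d²` on real polynomials in `d` variables. -/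
def laplacian (d : ℕ) : MvPolynomial (Fin d) ℝ →ₗ[ℝ] MvPolynomial (Fin d) ℝ :=
  ∑ i : Fin d, (MvPolynomial.pderiv i).toLinearMap ∘ₗ (MvPolynomial.pderiv i).toLinearMap

/-- `𝓗_n^d`: the real harmonic polynomials on `ℝ^d`, homogeneous of degree `n`. -/
def harmonicSubmodule (d n : ℕ) : Submodule ℝ (MvPolynomial (Fin d) ℝ) :=
  MvPolynomial.homogeneousSubmodule (Fin d) ℝ n ⊓ LinearMap.ker (laplacian d)

/-- The surface measure `σ` on the unit sphere of `ℝ^d`. -/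
def surfaceMeasure (d : ℕ) : Measure (Metric.sphere (0 : EuclideanSpace ℝ (Fin d)) 1) :=
  (volume : Measure (EuclideanSpace ℝ (Fin d))).toSphere

/-- The normalized inner product `⟨p, q⟩ = ω_d⁻¹ ∫ p q dσ` over the unit sphere of `ℝ^d`,
where `ω_d = σ(S^{d-1})` is the surface area. -/
def sphereInner (d : ℕ) (p q : MvPolynomial (Fin d) ℝ) : ℝ :=
  ((surfaceMeasure d).real Set.univ)⁻¹ *
    ∫ x : Metric.sphere (0 : EuclideanSpace ℝ (Fin d)) 1,
      MvPolynomial.eval (x : EuclideanSpace ℝ (Fin d)).ofLp p *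
        MvPolynomial.eval (x : EuclideanSpace ℝ (Fin d)).ofLp q ∂(surfaceMeasure d)

/-- The entry `v_j` of `v = (v_1, …, v_k)`, counted from `1` (and `0` when `j` is not in
`{1, …, k}`). -/
def entry {M : Type*} [Zero M] {k : ℕ} (v : Fin k → M) (j : ℕ) : M :=
  if h : 1 ≤ j ∧ j ≤ k then v ⟨j - 1, by omega⟩ else 0

/-- The admissible angles `θ = (θ_1, …, θ_{d-1})`:
`0 ≤ θ_1 ≤ 2π` and `0 ≤ θ_k ≤ π` for `2 ≤ k ≤ d - 1`. -/
def angleDomain (d : ℕ) : Set (Fin (d - 1) → ℝ) :=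
  {θ | (0 ≤ entry θ 1 ∧ entry θ 1 ≤ 2 * Real.pi) ∧
    ∀ k, 2 ≤ k → k ≤ d - 1 → 0 ≤ entry θ k ∧ entry θ k ≤ Real.pi}

/-- The point with spherical polar coordinates `(r, θ)`:
`x_1 = r sin θ_{d-1} ⋯ sin θ_1` and, for `2 ≤ k ≤ d`,
`x_k = r sin θ_{d-1} ⋯ sin θ_k cos θ_{k-1}`.
The variable `i : Fin d` stands for `k = i + 1`. -/
def sphericalPoint (d : ℕ) (r : ℝ) (θ : Fin (d - 1) → ℝ) : Fin d → ℝ := fun i =>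
  if (i : ℕ) = 0 then r * ∏ k ∈ Finset.Icc 1 (d - 1), Real.sin (entry θ k)
  else r * (∏ k ∈ Finset.Icc ((i : ℕ) + 1) (d - 1), Real.sin (entry θ k)) *
    Real.cos (entry θ (i : ℕ))

/-- The Pochhammer symbol `(a)_n = a (a + 1) ⋯ (a + n - 1)`. -/
def poch (a : ℝ) (n : ℕ) : ℝ := (ascPochhammer ℝ n).eval a

/-- The Gegenbauer polynomial
`C_n^μ(x) = (μ)_n 2^n / n! · x^n · ₂F₁(-n/2, (1-n)/2; 1-n-μ; 1/x²)`, for `μ > 0`. The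
hypergeometric series terminates at `j = ⌊n/2⌋`; the factor `x^n` is multiplied into it, so that
the formula is also correct at `x = 0`. -/
def gegenbauer (n : ℕ) (μ x : ℝ) : ℝ :=
  poch μ n * 2 ^ n / n.factorial *
    ∑ j ∈ Finset.range (n / 2 + 1),
      poch (-(n : ℝ) / 2) j * poch ((1 - (n : ℝ)) / 2) j /
        (j.factorial * poch (1 - (n : ℝ) - μ) j) * x ^ (n - 2 * j)

/-- `|α^j| = α_j + ⋯ + α_{d-1}`; the last entry `α_d` is not counted. -/
def tailSum {d : ℕ} (α : Fin d → ℕ) (j : ℕ) : ℕ := ∑ i ∈ Finset.Icc j (d - 1), entry α i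

/-- `λ_j = |α^{j+1}| + (d - j - 1) / 2`. -/
def lam {d : ℕ} (α : Fin d → ℕ) (j : ℕ) : ℝ := tailSum α (j + 1) + ((d : ℝ) - j - 1) / 2

/-- `[h_α]²`, with `b_α = 2` if `α_{d-1} + α_d > 0` and `b_α = 1` otherwise. -/
def hSq {d : ℕ} (α : Fin d → ℕ) : ℝ :=
  (if 0 < entry α (d - 1) + entry α d then 2 else 1) *
    ∏ j ∈ Finset.Icc 1 (d - 2),
      ((entry α j).factorial * poch (((d : ℝ) - j + 1) / 2) (tailSum α (j + 1)) *
          (((entry α j : ℕ) : ℝ) + lam α j)) /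
        (poch (2 * lam α j) (entry α j) * poch (((d : ℝ) - j) / 2) (tailSum α (j + 1)) * lam α j)

/-- The normalizing constant `h_α > 0`. -/
def h {d : ℕ} (α : Fin d → ℕ) : ℝ := Real.sqrt (hSq α)

/-- `g_α(θ_1)`: `cos (α_{d-1} θ_1)` if `α_d = 0`, and `sin (α_{d-1} θ_1)` if `α_d = 1`
(only these two values of `α_d` are used). -/
def g {d : ℕ} (α : Fin d → ℕ) (t : ℝ) : ℝ :=
  if entry α d = 0 then Real.cos (entry α (d - 1) * t) else Real.sin (entry α (d - 1) * t)

/-- The function `Y_α` in spherical coordinates `(r, θ)`; it has degree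
`|α^1| = α_1 + ⋯ + α_{d-1}`. -/
def Y {d : ℕ} (α : Fin d → ℕ) (r : ℝ) (θ : Fin (d - 1) → ℝ) : ℝ :=
  h α * r ^ tailSum α 1 * g α (entry θ 1) *
    ∏ j ∈ Finset.Icc 1 (d - 2),
      Real.sin (entry θ (d - j)) ^ tailSum α (j + 1) *
        gegenbauer (entry α j) (lam α j) (Real.cos (entry θ (d - j)))

/-- The indices of degree `n`: multi-indices `α ∈ ℕ₀^d` with `α_1 + ⋯ + α_{d-1} = n` whose last
entry is a label, `0` (cosine) or `1` (sine); the sine label requires `α_{d-1} ≥ 1`, since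
`sin (0 · θ_1)` vanishes identically. -/
def Index (d n : ℕ) : Type :=
  {α : Fin d → ℕ // tailSum α 1 = n ∧
    (entry α d = 0 ∨ (entry α d = 1 ∧ 1 ≤ entry α (d - 1)))}

end SphericalHarmonics

end

/-!
The idea is to compute with the expectation `E` under the standard Gaussian measure instead of the
integral over the sphere: by polar coordinates the two agree on homogeneous polynomials up to a
factor depending only on the degree, while `E` has the algebraic property `E (x_i p) = E (∂_i p)`.

If `p` is harmonic of degree `n` in `s` variables, one of which is `x`, then
`(2n + s - 2) x p - |x|² ∂p/∂x` is again harmonic. Applied repeatedly to a harmonic polynomial that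
does not depend on `x`, this raising operator reproduces the three-term recurrence of the
homogenized Gegenbauer polynomials. Hence `Y_α` is harmonic, being built up from a plane harmonic
`Re z^m` or `Im z^m` by adjoining one variable at a time; and as the adjoint of the raising operator
under `E` is a multiple of `∂/∂x`, the same recursion computes its norm.

If `α ≠ β`, then either at some stage of this construction the two polynomials have different
degrees and are orthogonal because the Casimir operator of the rotations of the variables involved
has different eigenvalues on them, or else they differ only in the choice of the real or the
imaginary part of `z^m`. Finally `Y_α` is a basis because a harmonic polynomial is determined by its
coefficients at monomials with exponent at most `1` at `x_d`, and there are as many of these as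
indices `α`.
-/

noncomputable section

namespace SphericalHarmonics

open MvPolynomial Finset

section Operators

variable {σ R : Type*} [CommRing R] {S : Finset σ} {n : ℕ} {p q : MvPolynomial σ R}

/-- The Laplacian in the variables of `S`, the other variables being treated as parameters. -/
def laplacianOn (S : Finset σ) : MvPolynomial σ R →ₗ[R] MvPolynomial σ R :=
  ∑ i ∈ S, (pderiv i).toLinearMap ∘ₗ (pderiv i).toLinearMap

/-- The squared Euclidean norm of the variables of `S`. -/
def sqSum (S : Finset σ) : MvPolynomial σ R := ∑ i ∈ S, X i ^ 2

theorem laplacianOn_apply (S : Finset σ) (p : MvPolynomial σ R) :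
    laplacianOn S p = ∑ i ∈ S, pderiv i (pderiv i p) := by
  simp [laplacianOn]

theorem pderiv_pderiv_comm (i j : σ) (p : MvPolynomial σ R) :
    pderiv i (pderiv j p) = pderiv j (pderiv i p) := by
  classical
  let partialDeriv (k : σ) : Derivation R (MvPolynomial σ R) (MvPolynomial σ R) := pderiv k
  have commutator_eq_zero : ⁅partialDeriv i, partialDeriv j⁆ = 0 := by
    refine derivation_ext fun k => ?_
    simp [partialDeriv, Derivation.commutator_apply, pderiv_X, Pi.single_apply, apply_ite]
  simpa [partialDeriv, Derivation.commutator_apply, sub_eq_zero] using congr($commutator_eq_zero p)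

theorem pderiv_eq_zero_of_mem_supported {i : σ} (hp : p ∈ supported R (S : Set σ)) (hi : i ∉ S) :
    pderiv i p = 0 :=
  pderiv_eq_zero_of_notMem_vars fun h => hi (mod_cast mem_supported.1 hp h)

theorem pderiv_mem_supported (hp : p ∈ supported R (S : Set σ)) (i : σ) :
    pderiv i p ∈ supported R (S : Set σ) := by
  classical
  rw [supported_eq_adjoin_X] at hp ⊢
  induction hp using Algebra.adjoin_induction with
  | mem x hx =>
    obtain ⟨j, -, rfl⟩ := hx
    rw [pderiv_X, Pi.single_apply]
    split_ifs <;> simp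
  | algebraMap r => simp
  | add x y _ _ hx hy => simpa using add_mem hx hy
  | mul x y hx' hy' hx hy =>
    rw [pderiv_mul]
    exact add_mem (mul_mem hx hy') (mul_mem hx' hy)

theorem sum_X_mul_pderiv_of_mem_supported (hp : p.IsHomogeneous n)
    (hS : p ∈ supported R (S : Set σ)) : ∑ i ∈ S, X i * pderiv i p = (n : R) • p := by
  have euler_monomial (e : σ →₀ ℕ) (he : e ∈ p.support) :
      ∑ i ∈ S, X i * pderiv i (monomial e (coeff e p)) = (n : R) • monomial e (coeff e p) := by
    have support_subset : e.support ⊆ S :=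
      (support_subset_vars_of_mem_support he).trans (mod_cast mem_supported.1 hS)
    have sum_exponents : ∑ i ∈ S, e i = n := by
      rw [hp.degree_eq_sum_deg_support he]
      exact (sum_subset support_subset fun i _ hi => Finsupp.notMem_support_iff.1 hi).symm
    simp only [X_mul_pderiv_monomial, ← sum_smul, sum_exponents, Nat.cast_smul_eq_nsmul]
  rw [p.as_sum, smul_sum, ← sum_congr rfl euler_monomial, sum_comm]
  simp only [map_sum, mul_sum]

theorem pderiv_sqSum_of_mem {i : σ} (hi : i ∈ S) :
    pderiv i (sqSum S : MvPolynomial σ R) = 2 * X i := by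
  classical
  simp [sqSum, pderiv_X, Pi.single_apply, hi]

theorem sqSum_insert [DecidableEq σ] {k : σ} (hk : k ∉ S) :
    (sqSum (insert k S) : MvPolynomial σ R) = X k ^ 2 + sqSum S :=
  sum_insert hk

theorem isHomogeneous_sqSum : (sqSum S : MvPolynomial σ R).IsHomogeneous 2 :=
  .sum _ _ _ fun i _ => (isHomogeneous_X R i).pow 2

theorem sqSum_mem_supported : (sqSum S : MvPolynomial σ R) ∈ supported R (S : Set σ) :=
  sum_mem fun _ hi => pow_mem (Algebra.subset_adjoin (Set.mem_image_of_mem X hi)) 2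

theorem laplacianOn_mul (p q : MvPolynomial σ R) :
    laplacianOn S (p * q) =
      laplacianOn S p * q + p * laplacianOn S q + 2 * ∑ i ∈ S, pderiv i p * pderiv i q := by
  simp only [laplacianOn_apply, pderiv_mul, map_add, mul_sum, sum_mul, ← sum_add_distrib]
  exact sum_congr rfl fun i _ => by ring

theorem laplacianOn_X_mul {k : σ} (hk : k ∈ S) (p : MvPolynomial σ R) :
    laplacianOn S (X k * p) = X k * laplacianOn S p + 2 * pderiv k p := by
  classical
  rw [laplacianOn_mul]
  simp [laplacianOn_apply, pderiv_X, Pi.single_apply, hk, apply_ite]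

theorem laplacianOn_sqSum : laplacianOn S (sqSum S) = (C (2 * #S) : MvPolynomial σ R) := by
  have pderiv_pderiv (i : σ) (hi : i ∈ S) :
      pderiv i (pderiv i (sqSum S)) = (C 2 : MvPolynomial σ R) := by
    rw [pderiv_sqSum_of_mem hi, ← map_ofNat C 2, pderiv_C_mul, pderiv_X_self, mul_one]
  rw [laplacianOn_apply, sum_congr rfl pderiv_pderiv]
  simp [mul_comm]

theorem laplacianOn_sqSum_mul (hp : p.IsHomogeneous n)
    (hS : p ∈ supported R (S : Set σ)) :
    laplacianOn S (sqSum S * p) = sqSum S * laplacianOn S p + (4 * n + 2 * #S : R) • p := by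
  have cross_terms : ∑ i ∈ S, pderiv i (sqSum S) * pderiv i p = 2 * (n : R) • p := by
    rw [← sum_X_mul_pderiv_of_mem_supported hp hS, mul_sum]
    exact sum_congr rfl fun i hi => by rw [pderiv_sqSum_of_mem hi, mul_assoc]
  rw [laplacianOn_mul, cross_terms, laplacianOn_sqSum, ← smul_eq_C_mul]
  algebra

/-- Homogeneous harmonic polynomials of degree `n` in the variables of `S` alone. -/
structure IsHarmonicOn (S : Finset σ) (n : ℕ) (p : MvPolynomial σ R) : Prop where
  isHomogeneous : p.IsHomogeneous n
  mem_supported : p ∈ supported R (S : Set σ)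
  laplacianOn_eq_zero : laplacianOn S p = 0

namespace IsHarmonicOn

protected theorem smul (hp : IsHarmonicOn S n p) (c : R) : IsHarmonicOn S n (c • p) where
  isHomogeneous := (homogeneousSubmodule σ R n).smul_mem c hp.isHomogeneous
  mem_supported := Subalgebra.smul_mem _ hp.mem_supported c
  laplacianOn_eq_zero := by rw [map_smul, hp.laplacianOn_eq_zero, smul_zero]

theorem pderiv_eq_zero_of_notMem (hp : IsHarmonicOn S n p) {i : σ} (hi : i ∉ S) :
    pderiv i p = 0 :=
  pderiv_eq_zero_of_mem_supported hp.mem_supported hi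

protected theorem insert [DecidableEq σ] (hp : IsHarmonicOn S n p) {k : σ} (hk : k ∉ S) :
    IsHarmonicOn (insert k S) n p where
  isHomogeneous := hp.isHomogeneous
  mem_supported := supported_mono (mod_cast subset_insert k S) hp.mem_supported
  laplacianOn_eq_zero := by
    rw [laplacianOn_apply, sum_insert hk, ← laplacianOn_apply, hp.laplacianOn_eq_zero,
      hp.pderiv_eq_zero_of_notMem hk, map_zero, add_zero]

protected theorem pderiv (hp : IsHarmonicOn S n p) (k : σ) :
    IsHarmonicOn S (n - 1) (pderiv k p) where
  isHomogeneous := hp.isHomogeneous.pderiv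
  mem_supported := pderiv_mem_supported hp.mem_supported k
  laplacianOn_eq_zero := by
    rw [laplacianOn_apply, sum_congr rfl fun i _ => by rw [pderiv_pderiv_comm i k p,
      pderiv_pderiv_comm i k], ← map_sum, ← laplacianOn_apply, hp.laplacianOn_eq_zero, map_zero]

end IsHarmonicOn

/-- The raising operator along the variable `k`: up to a scalar, the projection of `X k * p` onto
harmonic polynomials, for `p` harmonic of degree `n` in the variables of `S`. -/
def raise (S : Finset σ) (n : ℕ) (k : σ) (p : MvPolynomial σ R) : MvPolynomial σ R :=
  (2 * n + #S - 2 : R) • (X k * p) - sqSum S * pderiv k p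

theorem pderiv_eq_zero_of_isHomogeneous_zero (hp : p.IsHomogeneous 0) (k : σ) :
    pderiv k p = 0 := by
  rw [totalDegree_eq_zero_iff_eq_C.1 (Nat.le_zero.1 hp.totalDegree_le), pderiv_C]

theorem IsHarmonicOn.laplacianOn_sqSum_mul_pderiv (hp : IsHarmonicOn S n p) (k : σ) :
    laplacianOn S (sqSum S * pderiv k p) = (2 * (2 * n + #S - 2) : R) • pderiv k p := by
  obtain rfl | hn := n.eq_zero_or_pos
  · simp [pderiv_eq_zero_of_isHomogeneous_zero hp.isHomogeneous]
  · have hp' := hp.pderiv k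
    rw [laplacianOn_sqSum_mul hp'.isHomogeneous hp'.mem_supported, hp'.laplacianOn_eq_zero,
      mul_zero, zero_add]
    congr 1
    push_cast [hn]
    ring

theorem isHomogeneous_raise (hp : p.IsHomogeneous n) (S : Finset σ) (k : σ) :
    (raise S n k p).IsHomogeneous (n + 1) := by
  refine .sub ?_ ?_
  · have := (isHomogeneous_X R k).mul hp
    rw [add_comm] at this
    exact (homogeneousSubmodule σ R (n + 1)).smul_mem _ this
  · obtain rfl | hn := n.eq_zero_or_pos
    · simpa [pderiv_eq_zero_of_isHomogeneous_zero hp] using isHomogeneous_zero σ R 1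
    · have := isHomogeneous_sqSum (S := S).mul (hp.pderiv (i := k))
      rwa [show 2 + (n - 1) = n + 1 by lia] at this

protected theorem IsHarmonicOn.raise (hp : IsHarmonicOn S n p) {k : σ} (hk : k ∈ S) :
    IsHarmonicOn S (n + 1) (raise S n k p) where
  isHomogeneous := isHomogeneous_raise hp.isHomogeneous S k
  mem_supported :=
    sub_mem (Subalgebra.smul_mem _ (mul_mem (Algebra.subset_adjoin (Set.mem_image_of_mem X hk))
      hp.mem_supported) _) (mul_mem sqSum_mem_supported (pderiv_mem_supported hp.mem_supported k))
  laplacianOn_eq_zero := by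
    rw [raise, map_sub, map_smul, laplacianOn_X_mul hk, hp.laplacianOn_eq_zero,
      hp.laplacianOn_sqSum_mul_pderiv, mul_zero, zero_add]
    algebra

end Operators

section HomGegenbauer

variable {K A B : Type*} [Field K] [CommRing A] [Algebra K A] [CommRing B] [Algebra K B]

/-- The Gegenbauer polynomial `C_a^μ` homogenized in an element `s` standing for a squared norm:
`homGegenbauer μ s t a` plays the role of `√s ^ a * C_a^μ (t / √s)`. It is defined by the
three-term recurrence. -/
def homGegenbauer (μ : K) (s t : A) : ℕ → A
  | 0 => 1
  | 1 => (2 * μ) • t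
  | a + 2 => (a + 2 : K)⁻¹ • ((2 * (a + 1 + μ)) • (t * homGegenbauer μ s t (a + 1)) -
      (a + 2 * μ) • (s * homGegenbauer μ s t a))

variable (μ : K) (s t : A)

@[simp]
theorem homGegenbauer_zero : homGegenbauer μ s t 0 = 1 := by rw [homGegenbauer]

theorem homGegenbauer_one : homGegenbauer μ s t 1 = (2 * μ) • t := by rw [homGegenbauer]

theorem homGegenbauer_add_two (a : ℕ) :
    homGegenbauer μ s t (a + 2) =
      (a + 2 : K)⁻¹ • ((2 * (a + 1 + μ)) • (t * homGegenbauer μ s t (a + 1)) -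
        (a + 2 * μ) • (s * homGegenbauer μ s t a)) := by
  rw [homGegenbauer]

theorem map_homGegenbauer (φ : A →ₐ[K] B) (a : ℕ) :
    φ (homGegenbauer μ s t a) = homGegenbauer μ (φ s) (φ t) a := by
  induction a using Nat.twoStepInduction with
  | zero => simp
  | one => simp [homGegenbauer_one]
  | more a h0 h1 => simp [homGegenbauer_add_two, h0, h1]

theorem homGegenbauer_sq_mul_mul (c : A) (a : ℕ) :
    homGegenbauer μ (c ^ 2 * s) (c * t) a = c ^ a * homGegenbauer μ s t a := by
  induction a using Nat.twoStepInduction with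
  | zero => simp
  | one => simp [homGegenbauer_one]
  | more a h0 h1 =>
    rw [homGegenbauer_add_two, homGegenbauer_add_two, h0, h1]
    algebra

theorem derivation_homGegenbauer_eq_zero {s t : A} (D : Derivation K A A) (hs : D s = 0)
    (ht : D t = 0) (a : ℕ) : D (homGegenbauer μ s t a) = 0 := by
  induction a using Nat.twoStepInduction with
  | zero => simp
  | one => simp [homGegenbauer_one, ht]
  | more a h0 h1 => simp [homGegenbauer_add_two, h0, h1, hs, ht]

variable [CharZero K]

theorem homGegenbauer_recurrence (a : ℕ) :
    (a + 2 : K) • homGegenbauer μ s t (a + 2) =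
      (2 * (a + 1 + μ)) • (t * homGegenbauer μ s t (a + 1)) -
        (a + 2 * μ) • (s * homGegenbauer μ s t a) := by
  rw [homGegenbauer_add_two, smul_inv_smul₀ (by norm_cast)]

variable {s t}

theorem derivation_homGegenbauer_succ (D : Derivation K A A) (hs : D s = 2 * t) (ht : D t = 1)
    (a : ℕ) : D (homGegenbauer μ s t (a + 1)) = (a + 2 * μ) • homGegenbauer μ s t a := by
  induction a using Nat.twoStepInduction with
  | zero => simp [homGegenbauer_one, ht]
  | one =>
    rw [show 1 + 1 = 0 + 2 from rfl, homGegenbauer_add_two]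
    simp only [zero_add, homGegenbauer_one, homGegenbauer_zero, Derivation.map_smul, map_sub,
      Derivation.leibniz, hs, ht, Derivation.map_one_eq_zero, smul_eq_mul, Nat.cast_zero,
      Nat.cast_one]
    algebra
  | more a h0 h1 =>
    have recurrence := homGegenbauer_recurrence μ s t a
    have derivative := congr(D $(homGegenbauer_recurrence μ s t (a + 1)))
    simp only [Derivation.map_smul, map_sub, Derivation.leibniz, hs, ht, smul_eq_mul, h0, h1]
      at derivative
    refine smul_right_injective A (Nat.cast_add_one_ne_zero (R := K) (a + 2)) ?_
    push_cast at derivative ⊢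
    linear_combination (norm := algebra) derivative - (a + 1 + 2 * μ) • recurrence

theorem succ_smul_homGegenbauer_succ (D : Derivation K A A) (hs : D s = 2 * t) (ht : D t = 1)
    (a : ℕ) :
    (a + 1 : K) • homGegenbauer μ s t (a + 1) =
      (2 * (a + μ)) • (t * homGegenbauer μ s t a) - s * D (homGegenbauer μ s t a) := by
  cases a with
  | zero => simp [homGegenbauer_one]
  | succ a =>
    rw [derivation_homGegenbauer_succ μ D hs ht, mul_smul_comm]
    convert homGegenbauer_recurrence μ s t a using 2 <;> push_cast <;> ring

end HomGegenbauer

section Raise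

variable {σ K : Type*} [Field K] [CharZero K] [DecidableEq σ] {S : Finset σ} {N : ℕ} {k : σ}
  {q : MvPolynomial σ K}

theorem IsHarmonicOn.pderiv_homGegenbauer_succ_mul (hq : IsHarmonicOn S N q) (hk : k ∉ S) (μ : K)
    (a : ℕ) :
    pderiv k (homGegenbauer μ (sqSum (insert k S)) (X k) (a + 1) * q) =
      (a + 2 * μ) • (homGegenbauer μ (sqSum (insert k S)) (X k) a * q) := by
  rw [pderiv_mul, hq.pderiv_eq_zero_of_notMem hk, mul_zero, add_zero,
    derivation_homGegenbauer_succ μ _ (pderiv_sqSum_of_mem (mem_insert_self k S)) (pderiv_X_self k),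
    smul_mul_assoc]

theorem IsHarmonicOn.succ_smul_homGegenbauer_succ_mul (hq : IsHarmonicOn S N q) (hk : k ∉ S)
    {μ : K} (hμ : μ = N + (#S - 1) / 2) (a : ℕ) :
    (a + 1 : K) • (homGegenbauer μ (sqSum (insert k S)) (X k) (a + 1) * q) =
      raise (insert k S) (a + N) k (homGegenbauer μ (sqSum (insert k S)) (X k) a * q) := by
  rw [← smul_mul_assoc, succ_smul_homGegenbauer_succ μ _
    (pderiv_sqSum_of_mem (mem_insert_self k S)) (pderiv_X_self k), raise, pderiv_mul,
    hq.pderiv_eq_zero_of_notMem hk, mul_zero, add_zero, card_insert_of_notMem hk, sub_mul,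
    smul_mul_assoc, mul_assoc, mul_assoc, hμ]
  congr 2
  push_cast
  field

theorem IsHarmonicOn.homGegenbauer_mul (hq : IsHarmonicOn S N q) (hk : k ∉ S)
    {μ : K} (hμ : μ = N + (#S - 1) / 2) (a : ℕ) :
    IsHarmonicOn (insert k S) (a + N) (homGegenbauer μ (sqSum (insert k S)) (X k) a * q) := by
  induction a with
  | zero => simpa using hq.insert hk
  | succ a ih =>
    have raised := ih.raise (mem_insert_self k S)
    rw [← hq.succ_smul_homGegenbauer_succ_mul hk hμ] at raised
    have := raised.smul (a + 1 : K)⁻¹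
    rwa [inv_smul_smul₀ (by norm_cast), add_right_comm] at this

end Raise

section Rotation

variable {σ R : Type*} [CommRing R] {S : Finset σ} {n : ℕ} {p : MvPolynomial σ R}

/-- The generator of the rotations in the plane of the variables `i` and `j`. -/
def rotation (i j : σ) : Derivation R (MvPolynomial σ R) (MvPolynomial σ R) :=
  (X i : MvPolynomial σ R) • pderiv j - (X j : MvPolynomial σ R) • pderiv i

theorem rotation_apply (i j : σ) (p : MvPolynomial σ R) :
    rotation i j p = X i * pderiv j p - X j * pderiv i p :=
  rfl

theorem rotation_rotation [DecidableEq σ] (i j : σ) (p : MvPolynomial σ R) :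
    rotation i j (rotation i j p) =
      X i ^ 2 * pderiv j (pderiv j p) + X j ^ 2 * pderiv i (pderiv i p) -
        X i * pderiv i p - X j * pderiv j p - 2 * (X i * (X j * pderiv i (pderiv j p))) +
          if i = j then 2 * (X i * pderiv i p) else 0 := by
  rcases eq_or_ne i j with rfl | hij
  · simp only [rotation_apply, pderiv_mul, map_sub, pderiv_X_self, if_true]
    ring
  · simp only [rotation_apply, pderiv_mul, map_sub, pderiv_X_self, pderiv_X_of_ne hij,
      pderiv_X_of_ne hij.symm, if_neg hij, pderiv_pderiv_comm j i p]
    ring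

theorem sum_X_mul_X_mul_pderiv_pderiv (hp : p.IsHomogeneous n)
    (hS : p ∈ supported R (S : Set σ)) :
    ∑ i ∈ S, ∑ j ∈ S, X i * (X j * pderiv i (pderiv j p)) = (n * (n - 1) : R) • p := by
  classical
  have euler := sum_X_mul_pderiv_of_mem_supported hp hS
  have inner_sum (i : σ) (hi : i ∈ S) :
      ∑ j ∈ S, X i * (X j * pderiv i (pderiv j p)) = (n - 1 : R) • (X i * pderiv i p) := by
    have := congr(X i * pderiv i $euler)
    simp only [map_sum, pderiv_mul, pderiv_X, Pi.single_apply, ite_mul, one_mul, zero_mul,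
      sum_add_distrib, sum_ite_eq', hi, if_true, Derivation.map_smul] at this
    rw [← mul_sum]
    linear_combination (norm := algebra) this
  rw [sum_congr rfl inner_sum, ← smul_sum, euler, smul_smul, mul_comm]

/-- The left-hand side is the Casimir operator of the rotations of the variables of `S`. -/
theorem IsHarmonicOn.sum_rotation_rotation (hp : IsHarmonicOn S n p) :
    ∑ i ∈ S, ∑ j ∈ S, rotation i j (rotation i j p) = (-(2 * n * (n + #S - 2)) : R) • p := by
  classical
  have euler := sum_X_mul_pderiv_of_mem_supported hp.isHomogeneous hp.mem_supported
  have radial : ∑ i ∈ S, ∑ j ∈ S, X i ^ 2 * pderiv j (pderiv j p) = 0 := by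
    simp only [← mul_sum, ← laplacianOn_apply, hp.laplacianOn_eq_zero, mul_zero, sum_const_zero]
  have radial_symm : ∑ i ∈ S, ∑ j ∈ S, X j ^ 2 * pderiv i (pderiv i p) = 0 :=
    sum_comm.trans radial
  have mixed := sum_X_mul_X_mul_pderiv_pderiv hp.isHomogeneous hp.mem_supported
  have linear_left : ∑ i ∈ S, ∑ _j ∈ S, X i * pderiv i p = (#S * n : R) • p := by
    rw [sum_comm, sum_const, euler, ← Nat.cast_smul_eq_nsmul R, smul_smul]
  have linear_right : ∑ _i ∈ S, ∑ j ∈ S, X j * pderiv j p = (#S * n : R) • p :=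
    sum_comm.trans linear_left
  have diagonal : ∑ i ∈ S, ∑ j ∈ S, (if i = j then 2 * (X i * pderiv i p) else 0) =
      2 * (n : R) • p := by
    simp [← euler, mul_sum]
  simp only [rotation_rotation, sum_add_distrib, sum_sub_distrib, radial, radial_symm, linear_left,
    linear_right, diagonal, ← mul_sum (a := (2 : MvPolynomial σ R)), mixed]
  algebra

/-- The polynomials invariant under the rotations of the variables of `S`. -/
def rotationInvariants (R : Type*) [CommRing R] (S : Finset σ) :
    Subalgebra R (MvPolynomial σ R) where
  carrier := {f | ∀ i ∈ S, ∀ j ∈ S, rotation i j f = 0}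
  mul_mem' hf hg i hi j hj := by simp [hf i hi j hj, hg i hi j hj]
  add_mem' hf hg i hi j hj := by simp [hf i hi j hj, hg i hi j hj]
  algebraMap_mem' r i _ j _ := by simp

theorem sqSum_mem_rotationInvariants {T : Finset σ} (hST : S ⊆ T) :
    sqSum T ∈ rotationInvariants R S := fun i hi j hj => by
  rw [rotation_apply, pderiv_sqSum_of_mem (hST hi), pderiv_sqSum_of_mem (hST hj)]
  ring

theorem X_mem_rotationInvariants {k : σ} (hk : k ∉ S) : X k ∈ rotationInvariants R S :=
  fun i hi j hj => by
    rw [rotation_apply, pderiv_X_of_ne (ne_of_mem_of_not_mem hi hk).symm,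
      pderiv_X_of_ne (ne_of_mem_of_not_mem hj hk).symm, mul_zero, mul_zero, sub_zero]

end Rotation

theorem homGegenbauer_mem_rotationInvariants {σ K : Type*} [Field K] {S T : Finset σ} {k : σ}
    (hST : S ⊆ T) (hk : k ∉ S) (μ : K) (a : ℕ) :
    homGegenbauer μ (sqSum T) (X k) a ∈ rotationInvariants K S := fun i hi j hj =>
  derivation_homGegenbauer_eq_zero μ _ (sqSum_mem_rotationInvariants hST i hi j hj)
    (X_mem_rotationInvariants hk i hi j hj) a

/-- A linear functional that behaves like the expectation under the standard Gaussian measure: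
multiplication by a variable is adjoint to differentiation in the sense of integration by parts. -/
structure IsGaussian {σ R : Type*} [CommRing R] (E : MvPolynomial σ R →ₗ[R] R) : Prop where
  map_one : E 1 = 1
  map_X_mul (i : σ) (p : MvPolynomial σ R) : E (X i * p) = E (pderiv i p)

namespace IsGaussian

section CommRing

variable {σ R : Type*} [CommRing R] {E : MvPolynomial σ R →ₗ[R] R} {S : Finset σ} {n : ℕ}
  {p q f : MvPolynomial σ R}

theorem map_rotation (hE : IsGaussian E) (i j : σ) (p : MvPolynomial σ R) :
    E (rotation i j p) = 0 := by
  rw [rotation_apply, map_sub, hE.map_X_mul, hE.map_X_mul, pderiv_pderiv_comm, sub_self]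

theorem map_mul_rotation_mul (hE : IsGaussian E) {i j : σ} (hf : rotation i j f = 0)
    (p q : MvPolynomial σ R) : E (f * (rotation i j p * q)) = -E (f * (p * rotation i j q)) := by
  have := hE.map_rotation i j (f * (p * q))
  rw [Derivation.leibniz, Derivation.leibniz, hf, smul_zero, add_zero, smul_add, map_add] at this
  rw [← add_eq_zero_iff_eq_neg, ← this, add_comm]
  simp only [smul_eq_mul, mul_comm q]

theorem map_sqSum_mul (hE : IsGaussian E) (hp : p.IsHomogeneous n)
    (hS : p ∈ supported R (S : Set σ)) : E (sqSum S * p) = (n + #S) * E p := by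
  have pderiv_X_mul (i : σ) : E (X i ^ 2 * p) = E p + E (X i * pderiv i p) := by
    rw [sq, mul_assoc, hE.map_X_mul, pderiv_mul, pderiv_X_self, one_mul, map_add]
  rw [sqSum, sum_mul, map_sum, sum_congr rfl fun i _ => pderiv_X_mul i, sum_add_distrib,
    sum_const, ← map_sum E, sum_X_mul_pderiv_of_mem_supported hp hS, map_smul, nsmul_eq_mul,
    smul_eq_mul, add_mul, add_comm]

end CommRing

variable {σ K : Type*} [Field K] [CharZero K] {E : MvPolynomial σ K →ₗ[K] K}
  {S : Finset σ} {m n : ℕ} {p q f : MvPolynomial σ K}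

theorem map_sqSum_pow (hE : IsGaussian E) (S : Finset σ) (n : ℕ) :
    E (sqSum S ^ n) = 2 ^ n * (ascPochhammer K n).eval (#S / 2 : K) := by
  induction n with
  | zero => simp [hE.map_one]
  | succ n ih =>
    rw [pow_succ', hE.map_sqSum_mul (isHomogeneous_sqSum.pow n) (pow_mem sqSum_mem_supported n), ih,
      ascPochhammer_succ_eval]
    push_cast
    field

theorem map_mul_mul_eq_zero_of_ne (hE : IsGaussian E) (hS : 2 ≤ #S) (hp : IsHarmonicOn S m p)
    (hq : IsHarmonicOn S n q) (hmn : m ≠ n) (hf : f ∈ rotationInvariants K S) :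
    E (f * (p * q)) = 0 := by
  have casimir_symmetric : E (f * ((∑ i ∈ S, ∑ j ∈ S, rotation i j (rotation i j p)) * q)) =
      E (f * (p * ∑ i ∈ S, ∑ j ∈ S, rotation i j (rotation i j q))) := by
    simp only [sum_mul, mul_sum, map_sum]
    refine sum_congr rfl fun i hi => sum_congr rfl fun j hj => ?_
    rw [hE.map_mul_rotation_mul (hf i hi j hj), hE.map_mul_rotation_mul (hf i hi j hj), neg_neg]
  have eigenvalues_ne : ((m - n) * (m + n + #S - 2) : K) ≠ 0 := by
    refine mul_ne_zero (sub_ne_zero.2 (mod_cast hmn)) (sub_ne_zero.2 ?_)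
    norm_cast
    lia
  rw [hp.sum_rotation_rotation, hq.sum_rotation_rotation, smul_mul_assoc, mul_smul_comm,
    mul_smul_comm, mul_smul_comm, map_smul, map_smul, smul_eq_mul, smul_eq_mul] at casimir_symmetric
  refine (mul_eq_zero_iff_left eigenvalues_ne).1 ?_
  linear_combination -casimir_symmetric / 2

theorem map_raise_mul (hE : IsGaussian E) (hS : 2 ≤ #S) (hp : IsHarmonicOn S n p)
    (hq : IsHarmonicOn S (n + 1) q) {k : σ} :
    E (raise S n k p * q) = (2 * n + #S - 2) * E (p * pderiv k q) := by
  have lower_orthogonal {f : MvPolynomial σ K} (hf : f ∈ rotationInvariants K S) :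
      E (f * (pderiv k p * q)) = 0 :=
    hE.map_mul_mul_eq_zero_of_ne hS (hp.pderiv k) hq (by lia) hf
  have integrated : E (X k * p * q) = E (p * pderiv k q) := by
    rw [mul_assoc, hE.map_X_mul, pderiv_mul, map_add, ← one_mul (pderiv k p * q),
      lower_orthogonal (one_mem _), zero_add]
  rw [raise, sub_mul, smul_mul_assoc, map_sub, map_smul, integrated, mul_assoc (sqSum S),
    lower_orthogonal (sqSum_mem_rotationInvariants subset_rfl), sub_zero, smul_eq_mul]

theorem factorial_mul_map_homGegenbauer_mul_sq [DecidableEq σ] (hE : IsGaussian E)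
    (hS : 1 ≤ #S) (hq : IsHarmonicOn S n q) {k : σ} (hk : k ∉ S) {μ : K}
    (hμ : μ = n + (#S - 1) / 2) (a : ℕ) :
    a.factorial * E ((homGegenbauer μ (sqSum (insert k S)) (X k) a * q) ^ 2) =
      2 ^ a * (ascPochhammer K a).eval μ * (ascPochhammer K a).eval (2 * μ) * E (q ^ 2) := by
  induction a with
  | zero => simp
  | succ a ih =>
    have card_insert : #(insert k S) = #S + 1 := card_insert_of_notMem hk
    have step := hE.map_raise_mul (k := k) (by lia) (hq.homGegenbauer_mul hk hμ a)
      (add_right_comm a n 1 ▸ hq.homGegenbauer_mul hk hμ (a + 1))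
    rw [← hq.succ_smul_homGegenbauer_succ_mul hk hμ, hq.pderiv_homGegenbauer_succ_mul hk,
      smul_mul_assoc, mul_smul_comm, map_smul, map_smul, ← sq, ← sq, smul_eq_mul, smul_eq_mul,
      card_insert] at step
    rw [Nat.factorial_succ, ascPochhammer_succ_eval, ascPochhammer_succ_eval, pow_succ (2 : K)]
    push_cast at step ⊢
    rw [show (2 * (a + n) + (#S + 1) - 2 : K) = 2 * (a + μ) by rw [hμ]; ring] at step
    linear_combination a.factorial * step + 2 * (a + μ) * (a + 2 * μ) * ih

end IsGaussian

section Planar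

open scoped QuadraticAlgebra

/-- A derivation of `A`, extended to `A[√-1]` by acting on the real and imaginary parts. -/
def complexifiedDerivation {R A : Type*} [CommRing R] [CommRing A] [Algebra R A]
    (D : Derivation R A A) :
    Derivation R (QuadraticAlgebra A (-1) 0) (QuadraticAlgebra A (-1) 0) :=
  .mk'
    { toFun z := ⟨D z.re, D z.im⟩
      map_add' z w := by ext <;> simp
      map_smul' r z := by ext <;> simp }
    fun z w => by ext <;> simp <;> ring

variable {σ R : Type*} [CommRing R]

/-- The complex polynomial `(X i + √-1 * X j) ^ m`, whose real and imaginary parts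
`r ^ m * cos (m * θ)` and `r ^ m * sin (m * θ)` are the harmonic polynomials of degree `m` in the
plane of the variables `i` and `j`. -/
def planarPower (R : Type*) [CommRing R] (i j : σ) (m : ℕ) :
    QuadraticAlgebra (MvPolynomial σ R) (-1) 0 :=
  ⟨X i, X j⟩ ^ m

variable {i j : σ}

theorem re_planarPower_zero : (planarPower R i j 0).re = 1 := by
  rw [planarPower, pow_zero, QuadraticAlgebra.re_one]

theorem im_planarPower_zero : (planarPower R i j 0).im = 0 := by
  rw [planarPower, pow_zero, QuadraticAlgebra.im_one]

theorem re_planarPower_succ (m : ℕ) : (planarPower R i j (m + 1)).re =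
    (planarPower R i j m).re * X i - (planarPower R i j m).im * X j := by
  simp [planarPower, pow_succ, sub_eq_add_neg]

theorem im_planarPower_succ (m : ℕ) : (planarPower R i j (m + 1)).im =
    (planarPower R i j m).re * X j + (planarPower R i j m).im * X i := by
  simp [planarPower, pow_succ]

theorem re_sq_add_im_sq_planarPower [DecidableEq σ] (hij : i ≠ j) (m : ℕ) :
    (planarPower R i j m).re ^ 2 + (planarPower R i j m).im ^ 2 = sqSum {i, j} ^ m := by
  have norm_planarPower := map_pow QuadraticAlgebra.norm
    (⟨X i, X j⟩ : QuadraticAlgebra (MvPolynomial σ R) (-1) 0) m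
  rw [← planarPower, QuadraticAlgebra.norm_def, QuadraticAlgebra.norm_def] at norm_planarPower
  rw [sqSum, sum_pair hij]
  convert norm_planarPower using 1 <;> ring

theorem complexifiedDerivation_planarPower
    (D : Derivation R (MvPolynomial σ R) (MvPolynomial σ R)) (m : ℕ) :
    complexifiedDerivation D (planarPower R i j m) =
      m • (planarPower R i j (m - 1) * ⟨D (X i), D (X j)⟩) :=
  (complexifiedDerivation D).leibniz_pow _ m

theorem derivation_re_planarPower
    (D : Derivation R (MvPolynomial σ R) (MvPolynomial σ R)) (m : ℕ) :
    D (planarPower R i j m).re = m * ((planarPower R i j (m - 1)).re * D (X i) -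
      (planarPower R i j (m - 1)).im * D (X j)) := by
  refine congr($(complexifiedDerivation_planarPower D m).re).trans ?_
  simp [sub_eq_add_neg]

theorem derivation_im_planarPower
    (D : Derivation R (MvPolynomial σ R) (MvPolynomial σ R)) (m : ℕ) :
    D (planarPower R i j m).im = m * ((planarPower R i j (m - 1)).re * D (X j) +
      (planarPower R i j (m - 1)).im * D (X i)) := by
  refine congr($(complexifiedDerivation_planarPower D m).im).trans ?_
  simp

theorem rotation_re_planarPower (hij : i ≠ j) (m : ℕ) :
    rotation i j (planarPower R i j m).re = -(m * (planarPower R i j m).im) := by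
  rw [derivation_re_planarPower, rotation_apply, rotation_apply, pderiv_X_of_ne hij,
    pderiv_X_of_ne hij.symm, pderiv_X_self, pderiv_X_self]
  cases m with
  | zero => simp
  | succ m => rw [Nat.add_sub_cancel, im_planarPower_succ]; ring

theorem rotation_im_planarPower (hij : i ≠ j) (m : ℕ) :
    rotation i j (planarPower R i j m).im = m * (planarPower R i j m).re := by
  rw [derivation_im_planarPower, rotation_apply, rotation_apply, pderiv_X_of_ne hij,
    pderiv_X_of_ne hij.symm, pderiv_X_self, pderiv_X_self]
  cases m with
  | zero => simp
  | succ m => rw [Nat.add_sub_cancel, re_planarPower_succ]; ring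

theorem planarPower_isHomogeneous (i j : σ) (m : ℕ) :
    (planarPower R i j m).re.IsHomogeneous m ∧ (planarPower R i j m).im.IsHomogeneous m := by
  induction m with
  | zero =>
    rw [re_planarPower_zero, im_planarPower_zero]
    exact ⟨isHomogeneous_one σ R, isHomogeneous_zero σ R 0⟩
  | succ m ih =>
    have isHomogeneous_mul {p : MvPolynomial σ R} (hp : p.IsHomogeneous m) (k : σ) :
        (p * X k).IsHomogeneous (m + 1) := hp.mul (isHomogeneous_X R k)
    rw [re_planarPower_succ, im_planarPower_succ]
    exact ⟨(isHomogeneous_mul ih.1 i).sub (isHomogeneous_mul ih.2 j),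
      (isHomogeneous_mul ih.1 j).add (isHomogeneous_mul ih.2 i)⟩

variable [DecidableEq σ]

theorem planarPower_mem_supported (i j : σ) (m : ℕ) :
    (planarPower R i j m).re ∈ supported R (({i, j} : Finset σ) : Set σ) ∧
      (planarPower R i j m).im ∈ supported R (({i, j} : Finset σ) : Set σ) := by
  have X_mem {k : σ} (hk : k ∈ ({i, j} : Finset σ)) :
      X k ∈ supported R (({i, j} : Finset σ) : Set σ) :=
    Algebra.subset_adjoin (Set.mem_image_of_mem X hk)
  induction m with
  | zero =>
    rw [re_planarPower_zero, im_planarPower_zero]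
    exact ⟨one_mem _, zero_mem _⟩
  | succ m ih =>
    rw [re_planarPower_succ, im_planarPower_succ]
    exact ⟨sub_mem (mul_mem ih.1 (X_mem (by simp))) (mul_mem ih.2 (X_mem (by simp))),
      add_mem (mul_mem ih.1 (X_mem (by simp))) (mul_mem ih.2 (X_mem (by simp)))⟩

theorem isHarmonicOn_re_planarPower (hij : i ≠ j) (m : ℕ) :
    IsHarmonicOn {i, j} m (planarPower R i j m).re where
  isHomogeneous := (planarPower_isHomogeneous i j m).1
  mem_supported := (planarPower_mem_supported i j m).1
  laplacianOn_eq_zero := by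
    simp only [laplacianOn_apply, sum_pair hij, derivation_re_planarPower,
      derivation_im_planarPower, Derivation.leibniz, Derivation.map_natCast, map_sub, map_zero,
      pderiv_one, pderiv_X_self, pderiv_X_of_ne hij, pderiv_X_of_ne hij.symm, smul_eq_mul]
    ring

theorem isHarmonicOn_im_planarPower (hij : i ≠ j) (m : ℕ) :
    IsHarmonicOn {i, j} m (planarPower R i j m).im where
  isHomogeneous := (planarPower_isHomogeneous i j m).2
  mem_supported := (planarPower_mem_supported i j m).2
  laplacianOn_eq_zero := by
    simp only [laplacianOn_apply, sum_pair hij, derivation_re_planarPower,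
      derivation_im_planarPower, Derivation.leibniz, Derivation.map_natCast, map_add, map_zero,
      pderiv_one, pderiv_X_self, pderiv_X_of_ne hij, pderiv_X_of_ne hij.symm, smul_eq_mul]
    ring

end Planar

namespace IsGaussian

variable {σ K : Type*} [Field K] [CharZero K] {E : MvPolynomial σ K →ₗ[K] K} {i j : σ} {m : ℕ}

theorem map_mul_re_mul_im_planarPower [DecidableEq σ] (hE : IsGaussian E) (hij : i ≠ j) (hm : m ≠ 0)
    {f : MvPolynomial σ K} (hf : f ∈ rotationInvariants K {i, j}) :
    E (f * ((planarPower K i j m).re * (planarPower K i j m).im)) = 0 := by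
  have rotation_f : rotation i j f = 0 := hf i (by simp) j (by simp)
  have := hE.map_mul_rotation_mul rotation_f (planarPower K i j m).re (planarPower K i j m).re
  rw [rotation_re_planarPower hij, ← nsmul_eq_mul, mul_neg, neg_mul, mul_neg, mul_neg,
    smul_mul_assoc, mul_smul_comm, mul_smul_comm, mul_smul_comm, map_neg, map_neg, map_nsmul,
    map_nsmul, neg_neg, nsmul_eq_mul, nsmul_eq_mul, mul_comm (planarPower K i j m).im] at this
  refine (mul_eq_zero_iff_left (Nat.cast_ne_zero.2 hm : (m : K) ≠ 0)).1 ?_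
  linear_combination -this / 2

theorem map_planarPower_sq (hE : IsGaussian E) (hij : i ≠ j) (hm : m ≠ 0) :
    2 * E ((planarPower K i j m).re ^ 2) = 2 ^ m * m.factorial ∧
      2 * E ((planarPower K i j m).im ^ 2) = 2 ^ m * m.factorial := by
  classical
  have sum_eq : E ((planarPower K i j m).re ^ 2) + E ((planarPower K i j m).im ^ 2) =
      2 ^ m * m.factorial := by
    rw [← map_add, re_sq_add_im_sq_planarPower hij, hE.map_sqSum_pow, card_pair hij, Nat.cast_ofNat,
      div_self two_ne_zero, ascPochhammer_eval_one]
  have diff_eq : E ((planarPower K i j m).re ^ 2) - E ((planarPower K i j m).im ^ 2) = 0 := by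
    have := hE.map_rotation i j ((planarPower K i j m).re * (planarPower K i j m).im)
    rw [Derivation.leibniz, rotation_re_planarPower hij, rotation_im_planarPower hij, smul_eq_mul,
      smul_eq_mul, ← nsmul_eq_mul, ← nsmul_eq_mul, mul_smul_comm, mul_neg, mul_smul_comm, ← sq,
      ← sq, map_add, map_neg, map_nsmul, map_nsmul, ← sub_eq_add_neg, ← smul_sub] at this
    exact (smul_eq_zero_iff_right hm).1 this
  exact ⟨by linear_combination sum_eq + diff_eq, by linear_combination sum_eq - diff_eq⟩

end IsGaussian

section GaussianMeasure

/-- The unnormalized density `exp (-‖x‖² / 2)` of the standard Gaussian measure. -/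
def gaussianWeight {E : Type*} [Norm E] (x : E) : ℝ := Real.exp (-‖x‖ ^ 2 / 2)

theorem integrable_pow_mul_gaussianWeight (n : ℕ) :
    Integrable fun x : ℝ => x ^ n * gaussianWeight x := by
  have integrable_rpow := integrable_rpow_mul_exp_neg_mul_sq (b := 1 / 2) (by norm_num) (s := n)
    (by linarith [n.cast_nonneg (α := ℝ)])
  refine integrable_rpow.congr (.of_forall fun x => ?_)
  simp only [gaussianWeight, Real.rpow_natCast, Real.norm_eq_abs, sq_abs]
  congr 2
  ring

theorem hasFDerivAt_gaussianWeight {E : Type*} [NormedAddCommGroup E] [InnerProductSpace ℝ E]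
    (x : E) : HasFDerivAt gaussianWeight (-gaussianWeight x • innerSL ℝ x) x := by
  have hasFDerivAt_exponent :=
    (hasStrictFDerivAt_norm_sq x).hasFDerivAt.const_mul (-(1 / 2) : ℝ)
  refine (hasFDerivAt_exponent.exp.congr_fderiv ?_).congr_of_eventuallyEq (.of_forall fun y => ?_)
  · ext y
    simp [gaussianWeight, div_eq_inv_mul]
  · exact congrArg Real.exp (by ring)

theorem hasLineDerivAt_eval {ι : Type*} [DecidableEq ι] (p : MvPolynomial ι ℝ) (i : ι)
    (x : EuclideanSpace ℝ ι) :
    HasLineDerivAt ℝ (fun y : EuclideanSpace ℝ ι => eval y.ofLp p) (eval x.ofLp (pderiv i p)) x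
      (EuclideanSpace.single i 1) := by
  unfold HasLineDerivAt
  induction p using MvPolynomial.induction_on with
  | C a => simpa using hasDerivAt_const (0 : ℝ) a
  | add p q hp hq => simpa only [map_add] using hp.fun_add hq
  | mul_X p j hp =>
    have hasDerivAt_coord : HasDerivAt (fun t : ℝ => (x + t • EuclideanSpace.single i 1 :
        EuclideanSpace ℝ ι) j) ((Pi.single i 1 : ι → ℝ) j) 0 := by
      simpa [Pi.single_apply] using
        ((hasDerivAt_id (0 : ℝ)).mul_const ((Pi.single i 1 : ι → ℝ) j)).const_add (x j)
    simp only [map_mul, eval_X]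
    refine (hp.fun_mul hasDerivAt_coord).congr_deriv ?_
    rw [zero_smul, add_zero, pderiv_mul, pderiv_X, map_add, map_mul, map_mul, eval_X,
      Pi.single_apply, Pi.single_apply, apply_ite (eval _), map_one, map_zero]

variable {ι : Type*} [Fintype ι]

theorem integrable_eval_mul_gaussianWeight (p : MvPolynomial ι ℝ) :
    Integrable fun x : EuclideanSpace ℝ ι => eval x.ofLp p * gaussianWeight x := by
  induction p using MvPolynomial.induction_on' with
  | add p q hp hq => exact (hp.add hq).congr (.of_forall fun x => by simp [add_mul])
  | monomial e c =>
    rw [← (PiLp.volume_preserving_toLp ι).integrable_comp_emb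
      (MeasurableEquiv.toLp 2 _).measurableEmbedding]
    have integrable_prod := Integrable.fintype_prod (μ := fun _ => (volume : Measure ℝ))
      (f := fun (i : ι) x => x ^ e i * gaussianWeight x)
      fun i => integrable_pow_mul_gaussianWeight (e i)
    refine (integrable_prod.const_mul c).congr (.of_forall fun x => ?_)
    simp only [Function.comp_apply, eval_monomial, gaussianWeight, prod_mul_distrib,
      ← Real.exp_sum, EuclideanSpace.norm_sq_eq, Finsupp.prod_fintype _ _ fun i => pow_zero (x i),
      ← sum_div, sum_neg_distrib, mul_assoc]

theorem integral_gaussianWeight_pos : 0 < ∫ x : EuclideanSpace ℝ ι, gaussianWeight x := by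
  have integrable := integrable_eval_mul_gaussianWeight (1 : MvPolynomial ι ℝ)
  simp only [map_one, one_mul] at integrable
  have support_eq : Function.support (gaussianWeight : EuclideanSpace ℝ ι → ℝ) = Set.univ :=
    Function.support_eq_univ fun x => (Real.exp_pos _).ne'
  refine (integral_pos_iff_support_of_nonneg (f := gaussianWeight) (fun x => (Real.exp_pos _).le)
    integrable).2 ?_
  rw [support_eq]
  exact Measure.measure_univ_pos.2 (NeZero.ne _)

theorem hasLineDerivAt_gaussianWeight [DecidableEq ι] (i : ι) (x : EuclideanSpace ℝ ι) :
    HasLineDerivAt ℝ gaussianWeight (-(x i * gaussianWeight x)) x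
      (EuclideanSpace.single i 1) := by
  have directional : (-gaussianWeight x • innerSL ℝ x) (EuclideanSpace.single i 1) =
      -(x i * gaussianWeight x) := by
    simp [EuclideanSpace.inner_single_right, mul_comm]
  exact directional ▸ (hasFDerivAt_gaussianWeight x).hasLineDerivAt (EuclideanSpace.single i 1)

theorem integral_X_mul_gaussianWeight (i : ι) (p : MvPolynomial ι ℝ) :
    ∫ x : EuclideanSpace ℝ ι, eval x.ofLp (X i * p) * gaussianWeight x =
      ∫ x : EuclideanSpace ℝ ι, eval x.ofLp (pderiv i p) * gaussianWeight x := by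
  classical
  have eval_X_mul (x : EuclideanSpace ℝ ι) : eval x.ofLp (X i * p) * gaussianWeight x =
      -(eval x.ofLp p * -(x i * gaussianWeight x)) := by
    rw [map_mul, eval_X]
    ring
  have by_parts := integral_bilinear_hasLineDerivAt_right_eq_neg_left_of_integrable
    (μ := (volume : Measure (EuclideanSpace ℝ ι))) (B := ContinuousLinearMap.mul ℝ ℝ)
    (integrable_eval_mul_gaussianWeight (pderiv i p))
    ((integrable_eval_mul_gaussianWeight (X i * p)).neg.congr
      (.of_forall fun x => neg_eq_iff_eq_neg.2 (eval_X_mul x)))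
    (integrable_eval_mul_gaussianWeight p)
    (fun x _ => hasLineDerivAt_eval p i x) (fun x _ => hasLineDerivAt_gaussianWeight i x)
  simp only [ContinuousLinearMap.mul_apply'] at by_parts
  rw [← neg_inj, ← by_parts, ← integral_neg]
  simp only [eval_X_mul, neg_neg]

/-- The expectation of a polynomial under the standard Gaussian measure. -/
def gaussianExpectation (ι : Type*) [Fintype ι] : MvPolynomial ι ℝ →ₗ[ℝ] ℝ where
  toFun p := (∫ x : EuclideanSpace ℝ ι, gaussianWeight x)⁻¹ *
    ∫ x : EuclideanSpace ℝ ι, eval x.ofLp p * gaussianWeight x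
  map_add' p q := by
    simp only [map_add, add_mul]
    rw [integral_add (integrable_eval_mul_gaussianWeight p) (integrable_eval_mul_gaussianWeight q),
      mul_add]
  map_smul' c p := by
    simp only [smul_eval, mul_assoc, integral_const_mul, RingHom.id_apply, smul_eq_mul]
    ring

theorem gaussianExpectation_apply (p : MvPolynomial ι ℝ) :
    gaussianExpectation ι p = (∫ x : EuclideanSpace ℝ ι, gaussianWeight x)⁻¹ *
      ∫ x : EuclideanSpace ℝ ι, eval x.ofLp p * gaussianWeight x :=
  rfl

theorem isGaussian_gaussianExpectation : IsGaussian (gaussianExpectation ι) where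
  map_one := by
    simp only [gaussianExpectation_apply, map_one, one_mul]
    exact inv_mul_cancel₀ integral_gaussianWeight_pos.ne'
  map_X_mul i p := by
    rw [gaussianExpectation_apply, gaussianExpectation_apply, integral_X_mul_gaussianWeight]

end GaussianMeasure

section Sphere

theorem eval_smul_of_isHomogeneous {σ R : Type*} [CommSemiring R] {p : MvPolynomial σ R} {m : ℕ}
    (hp : p.IsHomogeneous m) (c : R) (x : σ → R) : eval (c • x) p = c ^ m * eval x p := by
  rw [eval_eq, eval_eq, mul_sum]
  refine sum_congr rfl fun e he => ?_
  have degree_eq : ∑ i ∈ e.support, e i = m := by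
    rw [← hp (mem_support_iff.1 he), Finsupp.weight_apply, Finsupp.sum]
    simp
  simp only [Pi.smul_apply, smul_eq_mul, mul_pow, prod_mul_distrib, prod_pow_eq_pow_sum, degree_eq]
  ring

variable {d m n : ℕ} {p q : MvPolynomial (Fin d) ℝ}

theorem integral_eval_mul_gaussianWeight_eq [NeZero d] (hp : p.IsHomogeneous m) :
    ∫ x : EuclideanSpace ℝ (Fin d), eval x.ofLp p * gaussianWeight x =
      (∫ x : Metric.sphere (0 : EuclideanSpace ℝ (Fin d)) 1,
        eval (x : EuclideanSpace ℝ (Fin d)).ofLp p ∂surfaceMeasure d) *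
      ∫ r : Set.Ioi (0 : ℝ), (r : ℝ) ^ m * gaussianWeight (r : ℝ)
        ∂Measure.volumeIoiPow (Module.finrank ℝ (EuclideanSpace ℝ (Fin d)) - 1) := by
  have integral_punctured := integral_subtype_comap (μ := volume)
    (measurableSet_singleton (0 : EuclideanSpace ℝ (Fin d))).compl
    fun x => eval x.ofLp p * gaussianWeight x
  rw [restrict_compl_singleton] at integral_punctured
  rw [← integral_punctured, surfaceMeasure, ← integral_prod_mul,
    ← (volume : Measure (EuclideanSpace ℝ (Fin d))).measurePreserving_homeomorphUnitSphereProd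
      |>.integral_comp (Homeomorph.measurableEmbedding _)]
  refine integral_congr_ae (.of_forall fun x => ?_)
  have norm_ne_zero : ‖(x : EuclideanSpace ℝ (Fin d))‖ ≠ 0 := norm_ne_zero_iff.2 x.2
  simp only [homeomorphUnitSphereProd_apply_fst_coe, homeomorphUnitSphereProd_apply_snd_coe,
    WithLp.ofLp_smul, gaussianWeight, norm_norm, eval_smul_of_isHomogeneous hp, inv_pow]
  field_simp

theorem integral_sphere_sqSum_pow (d n : ℕ) :
    ∫ x : Metric.sphere (0 : EuclideanSpace ℝ (Fin d)) 1,
      eval (x : EuclideanSpace ℝ (Fin d)).ofLp (sqSum univ ^ n) ∂surfaceMeasure d =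
      (surfaceMeasure d).real Set.univ := by
  have eval_eq_one (x : Metric.sphere (0 : EuclideanSpace ℝ (Fin d)) 1) :
      eval (x : EuclideanSpace ℝ (Fin d)).ofLp (sqSum univ ^ n) = 1 := by
    have sum_sq_eq_norm_sq := EuclideanSpace.real_norm_sq_eq (x : EuclideanSpace ℝ (Fin d))
    rw [norm_eq_of_mem_sphere] at sum_sq_eq_norm_sq
    simp [sqSum, ← sum_sq_eq_norm_sq]
  simp [eval_eq_one]

theorem gaussianExpectation_sqSum_pow_pos [NeZero d] (n : ℕ) :
    0 < gaussianExpectation (Fin d) (sqSum univ ^ n) := by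
  have := NeZero.pos d
  rw [isGaussian_gaussianExpectation.map_sqSum_pow, card_fin]
  have := ascPochhammer_pos n ((d : ℝ) / 2) (by positivity)
  positivity

theorem sphereInner_eq_gaussianExpectation_div [NeZero d] (hp : p.IsHomogeneous n)
    (hq : q.IsHomogeneous n) :
    sphereInner d p q =
      gaussianExpectation (Fin d) (p * q) / gaussianExpectation (Fin d) (sqSum univ ^ n) := by
  have isHomogeneous_sqSum_pow : (sqSum univ ^ n : MvPolynomial (Fin d) ℝ).IsHomogeneous (2 * n) :=
    isHomogeneous_sqSum.pow n
  have isHomogeneous_mul : (p * q).IsHomogeneous (2 * n) := two_mul n ▸ hp.mul hq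
  have normalizer_ne_zero := (gaussianExpectation_sqSum_pow_pos (d := d) n).ne'
  rw [gaussianExpectation_apply, integral_eval_mul_gaussianWeight_eq isHomogeneous_sqSum_pow]
    at normalizer_ne_zero
  rw [gaussianExpectation_apply, gaussianExpectation_apply,
    integral_eval_mul_gaussianWeight_eq isHomogeneous_sqSum_pow,
    integral_eval_mul_gaussianWeight_eq isHomogeneous_mul,
    mul_div_mul_left _ _ (left_ne_zero_of_mul normalizer_ne_zero),
    mul_div_mul_right _ _ (right_ne_zero_of_mul (right_ne_zero_of_mul normalizer_ne_zero)),
    integral_sphere_sqSum_pow, sphereInner, div_eq_inv_mul]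
  simp only [map_mul]

end Sphere

section Gegenbauer

variable {μ : ℝ}

theorem poch_zero (a : ℝ) : poch a 0 = 1 := by
  rw [poch, ascPochhammer_zero, Polynomial.eval_one]

theorem poch_succ (a : ℝ) (n : ℕ) : poch a (n + 1) = poch a n * (a + n) :=
  ascPochhammer_succ_eval n a

theorem poch_pos {a : ℝ} (ha : 0 < a) (n : ℕ) : 0 < poch a n :=
  ascPochhammer_pos n a ha

theorem poch_neg_half_mul_poch_one_sub_half {a j : ℕ} (hj : 2 * j ≤ a) :
    poch (-(a : ℝ) / 2) j * poch ((1 - (a : ℝ)) / 2) j * 4 ^ j * (a - 2 * j).factorial =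
      a.factorial := by
  induction j with
  | zero => simp [poch_zero]
  | succ j ih =>
    rw [← ih (by lia)]
    obtain ⟨m, rfl⟩ := Nat.exists_eq_add_of_le hj
    rw [show 2 * (j + 1) + m - 2 * j = m + 2 by lia,
      show 2 * (j + 1) + m - 2 * (j + 1) = m by lia, poch_succ, poch_succ,
      Nat.factorial_succ, Nat.factorial_succ]
    push_cast
    ring

theorem poch_one_sub_sub_mul_poch (μ : ℝ) {a j : ℕ} (hj : j ≤ a) :
    poch (1 - (a : ℝ) - μ) j * (-1) ^ j * poch μ (a - j) = poch μ a := by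
  induction j with
  | zero => simp [poch_zero]
  | succ j ih =>
    rw [← ih (by lia)]
    obtain ⟨m, rfl⟩ := Nat.exists_eq_add_of_le hj
    rw [show j + 1 + m - j = m + 1 by lia, show j + 1 + m - (j + 1) = m by lia, poch_succ,
      poch_succ]
    push_cast
    ring

/-- The coefficient of `x ^ (a - 2 * j)` in the Gegenbauer polynomial `C_a^μ`, as a function of all
natural numbers `a` and `j`. -/
def gegenbauerCoeff (μ : ℝ) (a j : ℕ) : ℝ :=
  if 2 * j ≤ a then
    (-1) ^ j * poch μ (a - j) * 2 ^ (a - 2 * j) / (j.factorial * (a - 2 * j).factorial)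
  else 0

theorem gegenbauerCoeff_of_lt {a j : ℕ} (hj : a < 2 * j) : gegenbauerCoeff μ a j = 0 :=
  if_neg hj.not_ge

theorem gegenbauerCoeff_add_two_mul (μ : ℝ) (m j : ℕ) :
    gegenbauerCoeff μ (m + 2 * j) j =
      (-1) ^ j * poch μ (m + j) * 2 ^ m / (j.factorial * m.factorial) := by
  rw [gegenbauerCoeff, if_pos (Nat.le_add_left _ _), Nat.add_sub_cancel,
    show m + 2 * j - j = m + j by lia]

theorem hypergeometric_coeff_eq_gegenbauerCoeff (hμ : 0 < μ) {a j : ℕ} (hj : 2 * j ≤ a) :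
    poch μ a * 2 ^ a / a.factorial *
        (poch (-(a : ℝ) / 2) j * poch ((1 - (a : ℝ)) / 2) j /
          (j.factorial * poch (1 - (a : ℝ) - μ) j)) = gegenbauerCoeff μ a j := by
  have numerator := poch_neg_half_mul_poch_one_sub_half hj
  have denominator := poch_one_sub_sub_mul_poch μ (show j ≤ a by lia)
  have denominator_ne_zero : poch (1 - (a : ℝ) - μ) j ≠ 0 :=
    left_ne_zero_of_mul (left_ne_zero_of_mul (denominator.trans_ne (poch_pos hμ a).ne'))
  have two_pow : (2 : ℝ) ^ a = 2 ^ (a - 2 * j) * 4 ^ j := by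
    rw [show (4 : ℝ) = 2 ^ 2 by norm_num, ← pow_mul, ← pow_add, Nat.sub_add_cancel hj]
  have numerator_ne_zero : poch (-(a : ℝ) / 2) j * poch ((1 - (a : ℝ)) / 2) j ≠ 0 :=
    left_ne_zero_of_mul (left_ne_zero_of_mul (numerator.trans_ne (by positivity)))
  rw [gegenbauerCoeff, if_pos hj, ← denominator, two_pow, ← numerator]
  generalize poch (-(a : ℝ) / 2) j * poch ((1 - (a : ℝ)) / 2) j = u at *
  field_simp

theorem gegenbauer_eq_sum_gegenbauerCoeff (hμ : 0 < μ) (x : ℝ) {a M : ℕ} (hM : a / 2 < M) :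
    gegenbauer a μ x = ∑ j ∈ range M, gegenbauerCoeff μ a j * x ^ (a - 2 * j) := by
  rw [← sum_subset (range_subset_range.2 (Nat.succ_le_of_lt hM)), gegenbauer, mul_sum]
  · refine sum_congr rfl fun j hj => ?_
    have := mem_range.1 hj
    rw [← hypergeometric_coeff_eq_gegenbauerCoeff hμ (show 2 * j ≤ a by lia), ← mul_assoc]
  · intro j _ hj
    have := mt mem_range.2 hj
    rw [gegenbauerCoeff_of_lt (by lia), zero_mul]

theorem gegenbauerCoeff_recurrence_zero (μ : ℝ) (a : ℕ) :
    ((a : ℝ) + 2) * gegenbauerCoeff μ (a + 2) 0 =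
      2 * (a + 1 + μ) * gegenbauerCoeff μ (a + 1) 0 := by
  simp only [gegenbauerCoeff, mul_zero, Nat.zero_le, if_true, tsub_zero, pow_zero,
    poch_succ μ (a + 1), Nat.factorial_succ (a + 1)]
  push_cast
  field

theorem gegenbauerCoeff_recurrence_succ (μ : ℝ) (a j : ℕ) :
    ((a : ℝ) + 2) * gegenbauerCoeff μ (a + 2) (j + 1) =
      2 * (a + 1 + μ) * gegenbauerCoeff μ (a + 1) (j + 1) -
        (a + 2 * μ) * gegenbauerCoeff μ a j := by
  rcases lt_or_ge a (2 * j) with ha | ha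
  · rw [gegenbauerCoeff_of_lt (by lia), gegenbauerCoeff_of_lt (by lia), gegenbauerCoeff_of_lt ha]
    ring
  obtain ⟨m, rfl⟩ := Nat.exists_eq_add_of_le' ha
  rw [show m + 2 * j + 2 = m + 2 * (j + 1) by lia, gegenbauerCoeff_add_two_mul,
    gegenbauerCoeff_add_two_mul, ← add_assoc, poch_succ, Nat.factorial_succ j]
  rcases m with - | m
  · rw [gegenbauerCoeff_of_lt (by lia)]
    push_cast
    field
  · rw [show m + 1 + 2 * j + 1 = m + 2 * (j + 1) by lia, gegenbauerCoeff_add_two_mul,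
      show m + (j + 1) = m + 1 + j by lia, Nat.factorial_succ j, Nat.factorial_succ m]
    push_cast
    field

theorem gegenbauer_recurrence (hμ : 0 < μ) (x : ℝ) (a : ℕ) :
    ((a : ℝ) + 2) * gegenbauer (a + 2) μ x =
      2 * (a + 1 + μ) * (x * gegenbauer (a + 1) μ x) - (a + 2 * μ) * gegenbauer a μ x := by
  have mul_summand (j : ℕ) : x * (gegenbauerCoeff μ (a + 1) j * x ^ (a + 1 - 2 * j)) =
      gegenbauerCoeff μ (a + 1) j * x ^ (a + 2 - 2 * j) := by
    rcases lt_or_ge (a + 1) (2 * j) with ha | ha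
    · rw [gegenbauerCoeff_of_lt ha, zero_mul, zero_mul, mul_zero]
    · rw [show a + 2 - 2 * j = a + 1 - 2 * j + 1 by lia, pow_succ]
      ring
  rw [gegenbauer_eq_sum_gegenbauerCoeff hμ x (show (a + 2) / 2 < a + 2 + 1 by lia),
    gegenbauer_eq_sum_gegenbauerCoeff hμ x (show (a + 1) / 2 < a + 2 + 1 by lia),
    gegenbauer_eq_sum_gegenbauerCoeff hμ x (show a / 2 < a + 2 by lia), mul_sum _ _ x]
  simp only [mul_summand]
  rw [sum_range_succ' _ (a + 2), sum_range_succ' _ (a + 2), mul_add, mul_add, ← mul_assoc,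
    ← mul_assoc, gegenbauerCoeff_recurrence_zero, mul_sum, mul_sum, mul_sum, add_sub_right_comm,
    ← sum_sub_distrib]
  congr 1
  refine sum_congr rfl fun j _ => ?_
  rw [← mul_assoc, gegenbauerCoeff_recurrence_succ, show a + 2 - 2 * (j + 1) = a - 2 * j by lia]
  ring

theorem homGegenbauer_one_eq_gegenbauer (hμ : 0 < μ) (x : ℝ) (a : ℕ) :
    homGegenbauer μ 1 x a = gegenbauer a μ x := by
  induction a using Nat.twoStepInduction with
  | zero => simp [gegenbauer, poch_zero]
  | one => simp [homGegenbauer_one, gegenbauer, poch_zero, poch_succ, mul_comm]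
  | more a h0 h1 =>
    have := homGegenbauer_recurrence μ 1 x a
    rw [smul_eq_mul, smul_eq_mul, smul_eq_mul, h0, h1, one_mul, ← gegenbauer_recurrence hμ] at this
    exact mul_left_cancel₀ (by positivity) this

end Gegenbauer

section MultiIndex

variable {d : ℕ} {α β : Fin d → ℕ} {j : ℕ}

theorem entry_of_le {M : Type*} [Zero M] (v : Fin d → M) (hj : 1 ≤ j) (hjd : j ≤ d) :
    entry v j = v ⟨j - 1, by lia⟩ :=
  dif_pos ⟨hj, hjd⟩

theorem tailSum_of_lt (hj : d - 1 < j) : tailSum α j = 0 := by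
  rw [tailSum, Icc_eq_empty_of_lt hj, sum_empty]

theorem tailSum_eq_entry_add (hj : j ≤ d - 1) : tailSum α j = entry α j + tailSum α (j + 1) := by
  rw [tailSum, tailSum, ← insert_Icc_add_one_left_eq_Icc hj, sum_insert (by simp)]

theorem tailSum_sub_one : tailSum α (d - 1) = entry α (d - 1) := by
  rw [tailSum, Icc_self, sum_singleton]

theorem sum_eq_tailSum_one_add_entry [NeZero d] (α : Fin d → ℕ) :
    ∑ i, α i = tailSum α 1 + entry α d := by
  obtain ⟨k, rfl⟩ := Nat.exists_eq_succ_of_ne_zero (NeZero.ne d)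
  rw [tailSum, Nat.succ_sub_one, ← Ico_add_one_right_eq_Icc,
    ← sum_Ico_succ_top (Nat.le_add_left 1 k), sum_Ico_eq_sum_range, sum_range]
  refine sum_congr rfl fun i _ => ?_
  simp only [entry_of_le α (Nat.le_add_right 1 i) (by lia), Nat.add_sub_cancel_left]

theorem eq_of_entry_eq (h : ∀ j, 1 ≤ j → j ≤ d → entry α j = entry β j) : α = β := by
  funext i
  have := h (i + 1) (Nat.le_add_left 1 i) i.2
  rwa [entry_of_le α (Nat.le_add_left 1 i) i.2, entry_of_le β (Nat.le_add_left 1 i) i.2] at this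

theorem lam_sub_eq (α : Fin d → ℕ) (i : Fin d) :
    lam α (d - i) = tailSum α (d - i + 1) + ((i : ℝ) - 1) / 2 := by
  rw [lam, Nat.cast_sub i.2.le]
  ring

theorem lam_sub_pos (α : Fin d → ℕ) {i : Fin d} (hi : 2 ≤ i.val) : 0 < lam α (d - i) := by
  have : (2 : ℝ) ≤ i := mod_cast hi
  rw [lam_sub_eq]
  linarith [(tailSum α (d - i + 1)).cast_nonneg (α := ℝ)]

theorem prod_Icc_sub_succ_add_one {M : Type*} [CommMonoid M] (f : ℕ → M) {i : Fin d}
    (hi : 2 ≤ i.val) : ∏ j ∈ Icc (d - (i + 1) + 1) (d - 2), f j =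
      f (d - i) * ∏ j ∈ Icc (d - i + 1) (d - 2), f j := by
  rw [show d - (i + 1) + 1 = d - i by lia,
    ← insert_Icc_add_one_left_eq_Icc (show d - i ≤ d - 2 by lia), prod_insert (by simp)]

end MultiIndex

section PartialHarmonic

variable {d : ℕ}

/-- The first `m` of the `d` variables. -/
def firstVars (d m : ℕ) : Finset (Fin d) :=
  {i | i.val < m}

theorem mem_firstVars {m : ℕ} {i : Fin d} : i ∈ firstVars d m ↔ i.val < m :=
  mem_filter_univ i

theorem firstVars_mono : Monotone (firstVars d) := fun _ _ h _ hi =>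
  mem_firstVars.2 ((mem_firstVars.1 hi).trans_le h)

theorem firstVars_self : firstVars d d = univ :=
  filter_true_of_mem fun i _ => i.2

theorem card_firstVars {m : ℕ} (hm : m ≤ d) : #(firstVars d m) = m :=
  Fin.card_filter_val_lt.trans (min_eq_right hm)

theorem firstVars_succ (i : Fin d) : firstVars d (i + 1) = insert i (firstVars d i) := by
  ext k
  rw [mem_insert, mem_firstVars, mem_firstVars, Fin.ext_iff]
  lia

theorem notMem_firstVars (i : Fin d) : i ∉ firstVars d i := fun hi =>
  (mem_firstVars.1 hi).false

@[elab_as_elim]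
theorem level_induction {P : ℕ → Prop} (two : P 2)
    (succ : ∀ i : Fin d, 2 ≤ i.val → P i → P (i + 1)) {m : ℕ} (hm : 2 ≤ m) (hmd : m ≤ d) :
    P m := by
  induction m, hm using Nat.le_induction with
  | base => exact two
  | succ m hm ih => exact succ ⟨m, hmd⟩ hm (ih (Nat.le_of_succ_le hmd))

variable [d.AtLeastTwo] {α β : Fin d → ℕ}

/-- The variable `x_1 = ρ sin θ_1`. -/
def sinVar (d : ℕ) [d.AtLeastTwo] : Fin d :=
  ⟨0, two_pos.trans_le Nat.AtLeastTwo.prop⟩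

/-- The variable `x_2 = ρ cos θ_1`. -/
def cosVar (d : ℕ) [d.AtLeastTwo] : Fin d :=
  ⟨1, one_lt_two.trans_le Nat.AtLeastTwo.prop⟩

theorem cosVar_ne_sinVar : cosVar d ≠ sinVar d :=
  Fin.ne_of_val_ne one_ne_zero

theorem firstVars_two : firstVars d 2 = {cosVar d, sinVar d} := by
  ext i
  rw [mem_firstVars, mem_insert, mem_singleton, Fin.ext_iff, Fin.ext_iff, cosVar, sinVar]
  lia

/-- The factor of `Y_α` in the plane of the first two variables: `ρ ^ α_{d-1} * g_α(θ_1)`. -/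
def planarFactor (α : Fin d → ℕ) : MvPolynomial (Fin d) ℝ :=
  if entry α d = 0 then (planarPower ℝ (cosVar d) (sinVar d) (entry α (d - 1))).re
  else (planarPower ℝ (cosVar d) (sinVar d) (entry α (d - 1))).im

/-- The Gegenbauer factor of `Y_α` with index `j = d - i`, homogenized in the first `i + 1`
variables. -/
def zonalFactor (α : Fin d → ℕ) (i : Fin d) : MvPolynomial (Fin d) ℝ :=
  homGegenbauer (lam α (d - i)) (sqSum (firstVars d (i + 1))) (X i) (entry α (d - i))

/-- The product of the factors of `Y_α` that belong to the first `m` variables; for `m = d` this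
is `Y_α / h_α`. -/
def partialHarmonic (α : Fin d → ℕ) (m : ℕ) : MvPolynomial (Fin d) ℝ :=
  planarFactor α * ∏ i : Fin d with 2 ≤ i.val ∧ i.val < m, zonalFactor α i

theorem partialHarmonic_two (α : Fin d → ℕ) : partialHarmonic α 2 = planarFactor α := by
  rw [partialHarmonic, filter_false_of_mem fun i _ hi => hi.1.not_gt hi.2, prod_empty, mul_one]

theorem partialHarmonic_succ (α : Fin d → ℕ) {i : Fin d} (hi : 2 ≤ i.val) :
    partialHarmonic α (i + 1) = zonalFactor α i * partialHarmonic α i := by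
  have insert_level : univ.filter (fun k : Fin d => 2 ≤ k.val ∧ k.val < i + 1) =
      insert i (univ.filter fun k : Fin d => 2 ≤ k.val ∧ k.val < i) := by
    ext k
    simp only [mem_insert, mem_filter_univ, Fin.ext_iff]
    lia
  rw [partialHarmonic, partialHarmonic, insert_level, prod_insert (by simp), mul_left_comm]

theorem isHarmonicOn_partialHarmonic (α : Fin d → ℕ) {m : ℕ} (hm : 2 ≤ m) (hmd : m ≤ d) :
    IsHarmonicOn (firstVars d m) (tailSum α (d - m + 1)) (partialHarmonic α m) := by
  refine level_induction ?_ (fun i hi ih => ?_) hm hmd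
  · rw [firstVars_two, partialHarmonic_two, planarFactor,
      show d - 2 + 1 = d - 1 by have := Nat.AtLeastTwo.prop (n := d); lia, tailSum_sub_one]
    split_ifs
    · exact isHarmonicOn_re_planarPower cosVar_ne_sinVar _
    · exact isHarmonicOn_im_planarPower cosVar_ne_sinVar _
  · rw [partialHarmonic_succ α hi, firstVars_succ, show d - (i + 1) + 1 = d - i by lia,
      tailSum_eq_entry_add (by lia), zonalFactor, firstVars_succ]
    refine ih.homGegenbauer_mul (notMem_firstVars i) ?_ _
    rw [lam_sub_eq, card_firstVars i.2.le]

theorem exists_partialHarmonic_eq_mul (α : Fin d → ℕ) {m : ℕ} (hm : 2 ≤ m) :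
    ∃ f ∈ rotationInvariants ℝ (firstVars d m),
      partialHarmonic α d = f * partialHarmonic α m := by
  refine ⟨∏ i : Fin d with m ≤ i.val, zonalFactor α i, prod_mem fun i hi => ?_, ?_⟩
  · have hmi := (mem_filter_univ i).1 hi
    exact homGegenbauer_mem_rotationInvariants (firstVars_mono (by lia))
      (fun him => hmi.not_gt (mem_firstVars.1 him)) _ _
  · rw [partialHarmonic, partialHarmonic, mul_left_comm, ← prod_union]
    · congr! 2
      ext i
      simp only [mem_union, mem_filter_univ]
      lia
    · exact disjoint_filter.2 fun i _ hmi him => hmi.not_gt him.2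

end PartialHarmonic

section Orthogonality

variable {d n : ℕ} [d.AtLeastTwo] {E : MvPolynomial (Fin d) ℝ →ₗ[ℝ] ℝ}

theorem exists_tailSum_ne_or_entry_ne {α β : Fin d → ℕ} (hαβ : α ≠ β) :
    (∃ m, 2 ≤ m ∧ m ≤ d ∧ tailSum α (d - m + 1) ≠ tailSum β (d - m + 1)) ∨
      entry α (d - 1) = entry β (d - 1) ∧ entry α d ≠ entry β d := by
  refine or_iff_not_imp_left.2 fun h => ?_
  push Not at h
  have tailSum_eq {j : ℕ} (hj : 1 ≤ j) : tailSum α j = tailSum β j := by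
    rcases lt_or_ge (d - 1) j with hdj | hjd
    · rw [tailSum_of_lt hdj, tailSum_of_lt hdj]
    · have := h (d - j + 1) (by lia) (by lia)
      rwa [show d - (d - j + 1) + 1 = j by lia] at this
  have entry_eq {j : ℕ} (hj : 1 ≤ j) (hjd : j ≤ d - 1) : entry α j = entry β j := by
    have := tailSum_eq hj
    rw [tailSum_eq_entry_add hjd, tailSum_eq_entry_add hjd, tailSum_eq (Nat.le_add_left 1 j)]
      at this
    exact Nat.add_right_cancel this
  have last_ne : entry α d ≠ entry β d := fun last_eq => hαβ <| eq_of_entry_eq fun j hj hjd => by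
    rcases hjd.eq_or_lt with rfl | hjd
    · exact last_eq
    · exact entry_eq hj (Nat.le_sub_one_of_lt hjd)
  have two_le_d := Nat.AtLeastTwo.prop (n := d)
  exact ⟨entry_eq (by lia) le_rfl, last_ne⟩

theorem IsGaussian.map_mul_planarFactor_mul_planarFactor (hE : IsGaussian E) {α β : Index d n}
    (hm : entry α.1 (d - 1) = entry β.1 (d - 1)) (hαβ : entry α.1 d ≠ entry β.1 d)
    {f : MvPolynomial (Fin d) ℝ} (hf : f ∈ rotationInvariants ℝ (firstVars d 2)) :
    E (f * (planarFactor α.1 * planarFactor β.1)) = 0 := by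
  rw [firstVars_two] at hf
  rw [planarFactor, planarFactor, ← hm]
  rcases α.2.2 with hα | ⟨hα, hα'⟩
  · rw [if_pos hα, if_neg fun hβ => hαβ (hα.trans hβ.symm)]
    have := β.2.2
    exact hE.map_mul_re_mul_im_planarPower cosVar_ne_sinVar (by lia) hf
  · rw [if_neg (by lia), if_pos (by have := β.2.2; lia), mul_comm (planarPower ..).im]
    exact hE.map_mul_re_mul_im_planarPower cosVar_ne_sinVar (by lia) hf

theorem IsGaussian.map_partialHarmonic_mul_partialHarmonic (hE : IsGaussian E) {α β : Index d n}
    (hαβ : α ≠ β) : E (partialHarmonic α.1 d * partialHarmonic β.1 d) = 0 := by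
  suffices ∃ m, 2 ≤ m ∧ ∀ f ∈ rotationInvariants ℝ (firstVars d m),
      E (f * (partialHarmonic α.1 m * partialHarmonic β.1 m)) = 0 by
    obtain ⟨m, hm, orthogonal⟩ := this
    obtain ⟨f, hf, α_eq⟩ := exists_partialHarmonic_eq_mul α.1 hm
    obtain ⟨g, hg, β_eq⟩ := exists_partialHarmonic_eq_mul β.1 hm
    rw [α_eq, β_eq, mul_mul_mul_comm]
    exact orthogonal _ (mul_mem hf hg)
  rcases exists_tailSum_ne_or_entry_ne (Subtype.coe_ne_coe.2 hαβ) with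
    ⟨m, hm, hmd, degree_ne⟩ | ⟨entry_eq, entry_ne⟩
  · exact ⟨m, hm, fun f hf => hE.map_mul_mul_eq_zero_of_ne ((card_firstVars hmd).symm ▸ hm)
      (isHarmonicOn_partialHarmonic α.1 hm hmd) (isHarmonicOn_partialHarmonic β.1 hm hmd)
      degree_ne hf⟩
  · refine ⟨2, le_rfl, fun f hf => ?_⟩
    rw [partialHarmonic_two, partialHarmonic_two]
    exact hE.map_mul_planarFactor_mul_planarFactor entry_eq entry_ne hf

end Orthogonality

section Normalization

theorem poch_add (a : ℝ) (m n : ℕ) : poch a (m + n) = poch a m * poch (a + m) n := by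
  rw [poch, ← ascPochhammer_mul, Polynomial.eval_mul, Polynomial.eval_comp]
  simp [poch]

theorem poch_mul_add (a : ℝ) (n : ℕ) : poch a n * (a + n) = a * poch (a + 1) n := by
  have := poch_add a 1 n
  rwa [add_comm 1 n, poch_succ, poch_succ, poch_zero, one_mul, Nat.cast_zero, Nat.cast_one,
    add_zero] at this

variable {d : ℕ}

/-- The factor of `[h_α]²` with index `j`. -/
def hSqFactor (α : Fin d → ℕ) (j : ℕ) : ℝ :=
  ((entry α j).factorial * poch (((d : ℝ) - j + 1) / 2) (tailSum α (j + 1)) *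
      (((entry α j : ℕ) : ℝ) + lam α j)) /
    (poch (2 * lam α j) (entry α j) * poch (((d : ℝ) - j) / 2) (tailSum α (j + 1)) * lam α j)

/-- The part of `[h_α]²` that normalizes `partialHarmonic α m`. -/
def partialHSq (α : Fin d → ℕ) (m : ℕ) : ℝ :=
  (if 0 < entry α (d - 1) + entry α d then 2 else 1) *
    ∏ j ∈ Icc (d - m + 1) (d - 2), hSqFactor α j

theorem partialHSq_self (α : Fin d → ℕ) : partialHSq α d = hSq α := by
  rw [partialHSq, Nat.sub_self]
  rfl

theorem hSqFactor_pos (α : Fin d → ℕ) {j : ℕ} (hj : j ∈ Icc 1 (d - 2)) : 0 < hSqFactor α j := by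
  obtain ⟨hj, hjd⟩ := mem_Icc.1 hj
  have lam_pos := lam_sub_pos α (i := ⟨d - j, by lia⟩) (show 2 ≤ d - j by lia)
  rw [Fin.val_mk, Nat.sub_sub_self (by lia)] at lam_pos
  have j_lt_d : (0 : ℝ) < d - j := sub_pos.2 (mod_cast show j < d by lia)
  have := poch_pos (half_pos j_lt_d) (tailSum α (j + 1))
  have := poch_pos (half_pos (add_pos j_lt_d one_pos)) (tailSum α (j + 1))
  have := poch_pos (mul_pos two_pos lam_pos) (entry α j)
  rw [hSqFactor]
  positivity

theorem hSq_pos (α : Fin d → ℕ) : 0 < hSq α :=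
  mul_pos (by split_ifs <;> norm_num) (prod_pos fun _ hj => hSqFactor_pos α hj)

theorem hSqFactor_mul_poch (α : Fin d → ℕ) {i : Fin d} (hi : 2 ≤ i.val) :
    hSqFactor α (d - i) * (2 ^ entry α (d - i) * poch (lam α (d - i)) (entry α (d - i)) *
      poch (2 * lam α (d - i)) (entry α (d - i))) *
        (2 ^ tailSum α (d - i + 1) * poch (i / 2) (tailSum α (d - i + 1))) =
      (entry α (d - i)).factorial *
        (2 ^ tailSum α (d - i) * poch ((i + 1) / 2) (tailSum α (d - i))) := by
  have lam_pos := lam_sub_pos α hi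
  have i_pos : (0 : ℝ) < i := mod_cast two_pos.trans_le hi
  have shift : (i + 1) / 2 + (tailSum α (d - i + 1) : ℝ) = lam α (d - i) + 1 := by
    rw [lam_sub_eq]
    ring
  have numerator := poch_mul_add (lam α (d - i)) (entry α (d - i))
  have := poch_pos (half_pos i_pos) (tailSum α (d - i + 1))
  have := poch_pos (mul_pos two_pos lam_pos) (entry α (d - i))
  rw [hSqFactor, Nat.cast_sub i.2.le, sub_sub_cancel,
    tailSum_eq_entry_add (show d - i ≤ d - 1 by lia),
    add_comm (entry α (d - i)) (tailSum α (d - i + 1)), poch_add, shift, pow_add]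
  field_simp
  linear_combination poch ((i + 1) / 2) (tailSum α (d - i + 1)) * numerator

theorem partialHSq_succ (α : Fin d → ℕ) {i : Fin d} (hi : 2 ≤ i.val) :
    partialHSq α (i + 1) = hSqFactor α (d - i) * partialHSq α i := by
  rw [partialHSq, prod_Icc_sub_succ_add_one _ hi, mul_left_comm, ← partialHSq]

variable {n : ℕ} [d.AtLeastTwo] {E : MvPolynomial (Fin d) ℝ →ₗ[ℝ] ℝ}

theorem IsGaussian.partialHSq_two_mul_map_planarFactor_sq (hE : IsGaussian E) (α : Index d n) :
    partialHSq α.1 2 * E (planarFactor α.1 ^ 2) =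
      2 ^ entry α.1 (d - 1) * (entry α.1 (d - 1)).factorial := by
  rw [partialHSq, Icc_eq_empty (by lia), prod_empty, mul_one, planarFactor]
  by_cases hm : entry α.1 (d - 1) = 0
  · have hlast : entry α.1 d = 0 := α.2.2.resolve_right fun h => by lia
    simp [hm, hlast, re_planarPower_zero, hE.map_one]
  · have norms := hE.map_planarPower_sq (cosVar_ne_sinVar (d := d)) hm
    rw [if_pos (by lia)]
    split_ifs
    · exact norms.1
    · exact norms.2

theorem IsGaussian.partialHSq_mul_map_partialHarmonic_sq (hE : IsGaussian E) (α : Index d n)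
    {m : ℕ} (hm : 2 ≤ m) (hmd : m ≤ d) : partialHSq α.1 m * E (partialHarmonic α.1 m ^ 2) =
      2 ^ tailSum α.1 (d - m + 1) * poch (m / 2) (tailSum α.1 (d - m + 1)) := by
  refine level_induction ?_ (fun i hi ih => ?_) hm hmd
  · rw [partialHarmonic_two, hE.partialHSq_two_mul_map_planarFactor_sq,
      show d - 2 + 1 = d - 1 by have := Nat.AtLeastTwo.prop (n := d); lia, tailSum_sub_one,
      Nat.cast_ofNat, div_self two_ne_zero, poch, ascPochhammer_eval_one]
  · have card := card_firstVars i.2.le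
    have map_sq := hE.factorial_mul_map_homGegenbauer_mul_sq (by lia)
      (isHarmonicOn_partialHarmonic α.1 hi i.2.le) (notMem_firstVars i)
      (by rw [lam_sub_eq, card] : lam α.1 (d - i) = _) (entry α.1 (d - i))
    rw [← firstVars_succ, ← zonalFactor, ← partialHarmonic_succ α.1 hi, ← poch, ← poch] at map_sq
    have telescope := hSqFactor_mul_poch α.1 hi
    have factorial_ne_zero : ((entry α.1 (d - i)).factorial : ℝ) ≠ 0 := by positivity
    refine mul_left_cancel₀ factorial_ne_zero ?_
    rw [partialHSq_succ α.1 hi, show d - (i + 1) + 1 = d - i by lia, Nat.cast_succ, ← telescope,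
      ← ih]
    linear_combination hSqFactor α.1 (d - i) * partialHSq α.1 i * map_sq

end Normalization

section PolarCoordinates

theorem eval_planarPower {σ : Type*} {i j : σ} {x : σ → ℝ} {ρ t : ℝ} (hi : x i = ρ * Real.cos t)
    (hj : x j = ρ * Real.sin t) (m : ℕ) :
    eval x (planarPower ℝ i j m).re = ρ ^ m * Real.cos (m * t) ∧
      eval x (planarPower ℝ i j m).im = ρ ^ m * Real.sin (m * t) := by
  induction m with
  | zero => simp [re_planarPower_zero, im_planarPower_zero]
  | succ m ih =>
    rw [re_planarPower_succ, im_planarPower_succ, map_sub, map_add, map_mul, map_mul, map_mul,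
      map_mul, ih.1, ih.2, eval_X, eval_X, hi, hj, Nat.cast_succ, add_one_mul, Real.cos_add,
      Real.sin_add]
    constructor <;> ring

variable {d : ℕ} {r : ℝ} {θ : Fin (d - 1) → ℝ}

/-- The length `r sin θ_{d-1} ⋯ sin θ_m` (up to sign, for arbitrary angles) of the projection of
`sphericalPoint d r θ` to the first `m` coordinates. -/
def projectedRadius (r : ℝ) (θ : Fin (d - 1) → ℝ) (m : ℕ) : ℝ :=
  r * ∏ k ∈ Icc m (d - 1), Real.sin (entry θ k)

theorem projectedRadius_self (hd : 1 ≤ d) : projectedRadius r θ d = r := by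
  rw [projectedRadius, Icc_eq_empty (by lia), prod_empty, mul_one]

theorem projectedRadius_eq_mul_sin {m : ℕ} (hm : m ≤ d - 1) :
    projectedRadius r θ m = projectedRadius r θ (m + 1) * Real.sin (entry θ m) := by
  rw [projectedRadius, projectedRadius, ← insert_Icc_add_one_left_eq_Icc hm,
    prod_insert (by simp), mul_left_comm, mul_comm (Real.sin _)]

theorem sphericalPoint_of_ne_zero {i : Fin d} (hi : i.val ≠ 0) :
    sphericalPoint d r θ i = projectedRadius r θ (i + 1) * Real.cos (entry θ i) :=
  if_neg hi

variable [d.AtLeastTwo]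

theorem sphericalPoint_cosVar :
    sphericalPoint d r θ (cosVar d) = projectedRadius r θ 2 * Real.cos (entry θ 1) :=
  sphericalPoint_of_ne_zero one_ne_zero

theorem sphericalPoint_sinVar :
    sphericalPoint d r θ (sinVar d) = projectedRadius r θ 2 * Real.sin (entry θ 1) := by
  have two_le_d := Nat.AtLeastTwo.prop (n := d)
  exact (if_pos rfl).trans (projectedRadius_eq_mul_sin (by lia))

theorem eval_sqSum_firstVars {m : ℕ} (hm : 2 ≤ m) (hmd : m ≤ d) :
    eval (sphericalPoint d r θ) (sqSum (firstVars d m)) = projectedRadius r θ m ^ 2 := by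
  refine level_induction ?_ (fun i hi ih => ?_) hm hmd
  · rw [firstVars_two, sqSum, sum_pair cosVar_ne_sinVar, map_add, map_pow, map_pow, eval_X, eval_X,
      sphericalPoint_cosVar, sphericalPoint_sinVar]
    linear_combination projectedRadius r θ 2 ^ 2 * Real.sin_sq_add_cos_sq (entry θ 1)
  · rw [firstVars_succ, sqSum_insert (notMem_firstVars i), map_add, map_pow, eval_X, ih,
      sphericalPoint_of_ne_zero (by lia), projectedRadius_eq_mul_sin (m := i) (by lia)]
    linear_combination projectedRadius r θ (i + 1) ^ 2 * Real.sin_sq_add_cos_sq (entry θ i)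

theorem eval_planarFactor (α : Fin d → ℕ) : eval (sphericalPoint d r θ) (planarFactor α) =
    projectedRadius r θ 2 ^ entry α (d - 1) * g α (entry θ 1) := by
  have values := eval_planarPower (sphericalPoint_cosVar (r := r) (θ := θ)) sphericalPoint_sinVar
    (entry α (d - 1))
  rw [planarFactor, g]
  split_ifs
  · exact values.1
  · exact values.2

theorem eval_zonalFactor (α : Fin d → ℕ) {i : Fin d} (hi : 2 ≤ i.val) :
    eval (sphericalPoint d r θ) (zonalFactor α i) =
      projectedRadius r θ (i + 1) ^ entry α (d - i) *
        gegenbauer (entry α (d - i)) (lam α (d - i)) (Real.cos (entry θ i)) := by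
  have eval_sqSum := eval_sqSum_firstVars (r := r) (θ := θ) (m := i.val + 1) (by lia) i.2
  rw [← coe_aeval_eq_eval, RingHom.coe_coe] at eval_sqSum ⊢
  rw [zonalFactor, map_homGegenbauer, aeval_X, sphericalPoint_of_ne_zero (by lia), eval_sqSum,
    ← mul_one (projectedRadius r θ (i + 1) ^ 2), homGegenbauer_sq_mul_mul,
    homGegenbauer_one_eq_gegenbauer (lam_sub_pos α hi)]

theorem eval_partialHarmonic (α : Fin d → ℕ) {m : ℕ} (hm : 2 ≤ m) (hmd : m ≤ d) :
    eval (sphericalPoint d r θ) (partialHarmonic α m) =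
      projectedRadius r θ m ^ tailSum α (d - m + 1) * g α (entry θ 1) *
        ∏ j ∈ Icc (d - m + 1) (d - 2), Real.sin (entry θ (d - j)) ^ tailSum α (j + 1) *
          gegenbauer (entry α j) (lam α j) (Real.cos (entry θ (d - j))) := by
  refine level_induction ?_ (fun i hi ih => ?_) hm hmd
  · rw [partialHarmonic_two, eval_planarFactor, Icc_eq_empty (by lia), prod_empty, mul_one,
      show d - 2 + 1 = d - 1 by lia, tailSum_sub_one]
  · rw [partialHarmonic_succ α hi, map_mul, eval_zonalFactor α hi, ih,
      prod_Icc_sub_succ_add_one _ hi, Nat.sub_sub_self i.2.le,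
      show d - (i + 1) + 1 = d - i by lia, tailSum_eq_entry_add (show d - i ≤ d - 1 by lia),
      projectedRadius_eq_mul_sin (m := i) (by lia)]
    ring

end PolarCoordinates

section Dimension

/-- `Δ p = 0` expresses the coefficients of `p` whose exponent at `i` is at least `2` through
coefficients with a smaller exponent at `i`. -/
theorem eq_zero_of_laplacianOn_eq_zero {σ R : Type*} [CommRing R] [NoZeroDivisors R] [CharZero R]
    {S : Finset σ} {i : σ} (hi : i ∈ S) {p : MvPolynomial σ R} (hp : laplacianOn S p = 0)
    (h : ∀ e : σ →₀ ℕ, e i ≤ 1 → coeff e p = 0) : p = 0 := by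
  classical
  ext e
  induction hk : e i using Nat.strong_induction_on generalizing e with
  | _ k ih =>
    rcases le_or_gt (e i) 1 with he | he
    · exact h e he
    obtain ⟨f, rfl⟩ : ∃ f, e = f + Finsupp.single i 1 + Finsupp.single i 1 := by
      refine ⟨e - Finsupp.single i 2, ?_⟩
      rw [add_assoc, ← Finsupp.single_add, tsub_add_cancel_of_le (Finsupp.single_le_iff.2 he)]
    have coeff_laplacian := congr(coeff f $hp)
    simp only [laplacianOn_apply, coeff_sum, coeff_pderiv, coeff_zero] at coeff_laplacian
    rw [sum_eq_single_of_mem i hi] at coeff_laplacian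
    · exact (mul_eq_zero.1 ((mul_eq_zero.1 coeff_laplacian).resolve_right
        (Nat.cast_add_one_ne_zero _))).resolve_right (Nat.cast_add_one_ne_zero _)
    · intro j _ hj
      rw [ih (f i) (by simp [← hk]) _ (by simp [hj]), coeff_zero, zero_mul, zero_mul]

variable {d n : ℕ} [d.AtLeastTwo]

/-- The variable `x_d`. -/
def lastVar (d : ℕ) [d.AtLeastTwo] : Fin d :=
  ⟨d - 1, by have := Nat.AtLeastTwo.prop (n := d); lia⟩

/-- The variable `x_{d-1}`. -/
def penultimateVar (d : ℕ) [d.AtLeastTwo] : Fin d :=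
  ⟨d - 1 - 1, by have := Nat.AtLeastTwo.prop (n := d); lia⟩

theorem lastVar_ne_penultimateVar : lastVar d ≠ penultimateVar d := by
  have := Nat.AtLeastTwo.prop (n := d)
  exact Fin.ne_of_val_ne (show d - 1 ≠ d - 1 - 1 by lia)

theorem entry_self (α : Fin d → ℕ) : entry α d = α (lastVar d) :=
  entry_of_le α (one_le_two.trans Nat.AtLeastTwo.prop) le_rfl

theorem entry_sub_one (α : Fin d → ℕ) : entry α (d - 1) = α (penultimateVar d) :=
  entry_of_le α (Nat.le_sub_one_of_lt Nat.AtLeastTwo.prop) (Nat.sub_le d 1)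

instance finite_index : Finite (Index d n) := by
  refine (Set.finite_Iic (fun _ : Fin d => n + 1)).subset fun α ⟨degree_eq, label⟩ i => ?_
  have sum_eq := sum_eq_tailSum_one_add_entry α
  have le_sum := single_le_sum (f := α) (fun _ _ => Nat.zero_le _) (mem_univ i)
  change α i ≤ n + 1
  lia

/-- The exponent of the monomial attached to `α`, which arises from `α` by subtracting the label
`α_d` from `α_{d-1}`. These are exactly the exponents of degree `n` with last entry at most `1`. -/
def indexExponent (α : Index d n) : Fin d →₀ ℕ :=
  Finsupp.equivFunOnFinite.symm α.1 - Finsupp.single (penultimateVar d) (α.1 (lastVar d))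

theorem exists_indexExponent_eq {e : Fin d →₀ ℕ} (he : e.degree = n) (hlast : e (lastVar d) ≤ 1) :
    ∃ α : Index d n, indexExponent α = e := by
  set α : Fin d →₀ ℕ := e + Finsupp.single (penultimateVar d) (e (lastVar d)) with hα
  have last_eq : α (lastVar d) = e (lastVar d) := by
    simp [hα, Finsupp.single_eq_of_ne lastVar_ne_penultimateVar]
  have penultimate_eq : α (penultimateVar d) = e (penultimateVar d) + e (lastVar d) := by
    simp [hα]
  have degree_eq : ∑ i, α i = n + e (lastVar d) := by
    rw [← Finsupp.degree_eq_sum, hα, map_add, he, Finsupp.degree_single]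
  rw [sum_eq_tailSum_one_add_entry, entry_self, last_eq] at degree_eq
  refine ⟨⟨α, Nat.add_right_cancel degree_eq, ?_⟩, ?_⟩
  · rw [entry_self, entry_sub_one, last_eq, penultimate_eq]
    lia
  · change Finsupp.equivFunOnFinite.symm α - Finsupp.single _ (α (lastVar d)) = e
    rw [last_eq, Finsupp.equivFunOnFinite_symm_coe, hα, add_tsub_cancel_right]

/-- The coefficients that determine a harmonic polynomial. -/
def indexCoeff (d n : ℕ) [d.AtLeastTwo] : harmonicSubmodule d n →ₗ[ℝ] Index d n → ℝ :=
  LinearMap.pi fun α => lcoeff ℝ (indexExponent α) ∘ₗ (harmonicSubmodule d n).subtype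

theorem indexCoeff_injective : Function.Injective (indexCoeff d n) := by
  refine (injective_iff_map_eq_zero _).2 fun ⟨p, hp⟩ h => Subtype.ext ?_
  obtain ⟨homogeneous, harmonic⟩ := Submodule.mem_inf.1 hp
  refine eq_zero_of_laplacianOn_eq_zero (mem_univ (lastVar d)) harmonic fun e he => ?_
  by_cases degree_eq : e.degree = n
  · obtain ⟨α, rfl⟩ := exists_indexExponent_eq degree_eq he
    exact congrFun h α
  · exact IsHomogeneous.coeff_eq_zero homogeneous degree_eq

end Dimension

section Basis

variable {d n : ℕ} [d.AtLeastTwo] {α β : Index d n}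

theorem partialHarmonic_mem_harmonicSubmodule (α : Index d n) :
    partialHarmonic α.1 d ∈ harmonicSubmodule d n := by
  have harmonic := isHarmonicOn_partialHarmonic α.1 Nat.AtLeastTwo.prop le_rfl
  rw [firstVars_self, Nat.sub_self, zero_add, α.2.1] at harmonic
  exact Submodule.mem_inf.2 ⟨harmonic.isHomogeneous, harmonic.laplacianOn_eq_zero⟩

/-- The spherical harmonic `Y_α` as an element of `𝓗_n^d`. -/
def sphericalHarmonic (α : Index d n) : harmonicSubmodule d n :=
  h α.1 • ⟨partialHarmonic α.1 d, partialHarmonic_mem_harmonicSubmodule α⟩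

theorem coe_sphericalHarmonic (α : Index d n) :
    (sphericalHarmonic α : MvPolynomial (Fin d) ℝ) = h α.1 • partialHarmonic α.1 d :=
  rfl

theorem isHomogeneous_sphericalHarmonic (α : Index d n) :
    (sphericalHarmonic α : MvPolynomial (Fin d) ℝ).IsHomogeneous n :=
  (Submodule.mem_inf.1 (sphericalHarmonic α).2).1

theorem eval_sphericalHarmonic (α : Index d n) (r : ℝ) (θ : Fin (d - 1) → ℝ) :
    eval (sphericalPoint d r θ) (sphericalHarmonic α : MvPolynomial (Fin d) ℝ) = Y α.1 r θ := by
  have two_le_d := Nat.AtLeastTwo.prop (n := d)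
  rw [coe_sphericalHarmonic, smul_eval, eval_partialHarmonic α.1 two_le_d le_rfl,
    projectedRadius_self (one_le_two.trans two_le_d), Nat.sub_self, zero_add, Y, mul_assoc,
    mul_assoc, mul_assoc (h α.1)]

theorem IsGaussian.map_sphericalHarmonic_mul_self {E : MvPolynomial (Fin d) ℝ →ₗ[ℝ] ℝ}
    (hE : IsGaussian E) (α : Index d n) :
    E (sphericalHarmonic α * sphericalHarmonic α) = E (sqSum univ ^ n) := by
  have norm_eq := hE.partialHSq_mul_map_partialHarmonic_sq α Nat.AtLeastTwo.prop le_rfl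
  rw [partialHSq_self, Nat.sub_self, zero_add, α.2.1] at norm_eq
  rw [coe_sphericalHarmonic, smul_mul_smul_comm, map_smul, smul_eq_mul, h,
    Real.mul_self_sqrt (hSq_pos α.1).le, ← sq, norm_eq, hE.map_sqSum_pow, card_fin, poch]

theorem IsGaussian.map_sphericalHarmonic_mul {E : MvPolynomial (Fin d) ℝ →ₗ[ℝ] ℝ}
    (hE : IsGaussian E) (hαβ : α ≠ β) : E (sphericalHarmonic α * sphericalHarmonic β) = 0 := by
  rw [coe_sphericalHarmonic, coe_sphericalHarmonic, smul_mul_smul_comm, map_smul,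
    hE.map_partialHarmonic_mul_partialHarmonic hαβ, smul_zero]

theorem sphereInner_sphericalHarmonic_self (α : Index d n) :
    sphereInner d (sphericalHarmonic α) (sphericalHarmonic α) = 1 := by
  rw [sphereInner_eq_gaussianExpectation_div (isHomogeneous_sphericalHarmonic α)
    (isHomogeneous_sphericalHarmonic α),
    isGaussian_gaussianExpectation.map_sphericalHarmonic_mul_self,
    div_self (gaussianExpectation_sqSum_pow_pos n).ne']

theorem sphereInner_sphericalHarmonic_of_ne (hαβ : α ≠ β) :
    sphereInner d (sphericalHarmonic α) (sphericalHarmonic β) = 0 := by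
  rw [sphereInner_eq_gaussianExpectation_div (isHomogeneous_sphericalHarmonic α)
    (isHomogeneous_sphericalHarmonic β),
    isGaussian_gaussianExpectation.map_sphericalHarmonic_mul hαβ, zero_div]

theorem linearIndependent_sphericalHarmonic :
    LinearIndependent ℝ (sphericalHarmonic : Index d n → harmonicSubmodule d n) := by
  refine .of_comp (harmonicSubmodule d n).subtype <| LinearMap.linearIndependent_of_isOrthoᵢ
    (B := (LinearMap.mul ℝ (MvPolynomial (Fin d) ℝ)).compr₂ (gaussianExpectation (Fin d)))
    (fun α β hαβ => isGaussian_gaussianExpectation.map_sphericalHarmonic_mul hαβ) fun α => ?_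
  exact (isGaussian_gaussianExpectation.map_sphericalHarmonic_mul_self α).trans_ne
    (gaussianExpectation_sqSum_pow_pos n).ne'

theorem span_sphericalHarmonic_eq_top :
    Submodule.span ℝ (Set.range (sphericalHarmonic : Index d n → harmonicSubmodule d n)) = ⊤ := by
  have := Fintype.ofFinite (Index d n)
  have : Module.Finite ℝ (harmonicSubmodule d n) := .of_injective _ indexCoeff_injective
  have finrank_le := LinearMap.finrank_le_finrank_of_injective
    (indexCoeff_injective (d := d) (n := n))
  rw [Module.finrank_fintype_fun_eq_card] at finrank_le
  have linearIndependent := linearIndependent_sphericalHarmonic (d := d) (n := n)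
  exact linearIndependent.span_eq_top_of_card_eq_finrank'
    (linearIndependent.fintype_card_le_finrank.antisymm finrank_le)

/-- The basis of `𝓗_n^d` formed by the spherical harmonics `Y_α`. -/
def sphericalHarmonicBasis (d n : ℕ) [d.AtLeastTwo] :
    Module.Basis (Index d n) ℝ (harmonicSubmodule d n) :=
  .mk linearIndependent_sphericalHarmonic span_sphericalHarmonic_eq_top.ge

theorem sphericalHarmonicBasis_apply (α : Index d n) :
    sphericalHarmonicBasis d n α = sphericalHarmonic α :=
  Module.Basis.mk_apply _ _ α

end Basis

end SphericalHarmonics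

end

open SphericalHarmonics in
theorem mainTheorem8_general {d : ℕ} (hd : 2 ≤ d) (n : ℕ) :
    ∃ B : Module.Basis (Index d n) ℝ (harmonicSubmodule d n),
      (∀ (α : Index d n) (r : ℝ) (θ : Fin (d - 1) → ℝ),
        MvPolynomial.eval (sphericalPoint d r θ) (B α : MvPolynomial (Fin d) ℝ) = Y α.1 r θ) ∧
      (∀ α : Index d n, sphereInner d (B α) (B α) = 1) ∧
      (∀ α β : Index d n, α ≠ β → sphereInner d (B α) (B β) = 0) := by
  have : d.AtLeastTwo := ⟨hd⟩
  refine ⟨sphericalHarmonicBasis d n, ?_⟩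
  simp only [sphericalHarmonicBasis_apply]
  exact ⟨eval_sphericalHarmonic, sphereInner_sphericalHarmonic_self,
    fun _ _ => sphereInner_sphericalHarmonic_of_ne⟩

open SphericalHarmonics in
theorem mainTheorem8 (d : ℕ) (hd : 2 < d) (n : ℕ) :
    ∃ B : Module.Basis (Index d n) ℝ (harmonicSubmodule d n),
      (∀ (α : Index d n) (r : ℝ) (θ : Fin (d - 1) → ℝ), 0 ≤ r → θ ∈ angleDomain d →
        MvPolynomial.eval (sphericalPoint d r θ) (B α : MvPolynomial (Fin d) ℝ) = Y α.1 r θ) ∧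
      (∀ α : Index d n, sphereInner d (B α) (B α) = 1) ∧
      (∀ α β : Index d n, α ≠ β → sphereInner d (B α) (B β) = 0) := by
  obtain ⟨B, eval_B, orthonormal⟩ := mainTheorem8_general hd.le n
  exact ⟨B, fun α r θ _ _ => eval_B α r θ, orthonormal⟩
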